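/- Let $\mathbb{F}_q$ be a finite field with $q$ elements, $A=\mathbb{F}_q[\theta]$, $K=\mathbb{F}_q(\theta)$ with the absolute value determined by $|a|=q^{\deg_\theta a}$ for $0\neq a\in A$, $K_\infty$ the completion of $K$, $\mathbb{C}_\infty$ the completion of an algebraic closure of $K_\infty$, and $\Omega=\mathbb{C}_\infty\setminus K_\infty$ the Drinfeld upper half-plane. For $0\ne\varpi\in\mathbb{C}_\infty$ put $e_{\varpi A}(\zeta)=\zeta\prod_{0\ne a\in A}\bigl(1-\frac{\zeta}{\varpi a}\bigr)$, and fix $\tilde\pi\neq 0$ such that $\tilde\pi A$ is the lattice of the Carlitz module, i.e. $e_{\tilde\pi A}(\theta\zeta)=\theta e_{\tilde\pi A}(\zeta)+e_{\tilde\pi A}(\zeta)^q$ for all $\zeta\in\mathbb{C}_\infty$. Put $u(z)=1/e_{\tilde\pi A}(\tilde\pi z)$ and $u_c(z)=u(cz)$ for monic $c\in A$. A Drinfeld modular form of weight $w$ and type $m$ is a rigid-analytic function $f:\Omega\to\mathbb{C}_\infty$ such that $f\bigl(\frac{az+b}{cz+d}\bigr)=(cz+d)^w\det(\gamma)^{-m}f(z)$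 for all $\gamma=\begin{pmatrix}a&b\\c&d\end{pmatrix}\in \mathrm{GL}_2(A)$ and $z\in\Omega$, and such that there are $a_n\in\mathbb{C}_\infty$ and $\delta>0$ with $f(z)=\sum_{n\ge0}a_nu(z)^n$ whenever $|z|_i:=\inf_{x\in K_\infty}|z-x|>\delta$. It is an eigenform if it is not identically zero and, for every monic irreducible $p\in A$, it is an eigenvector of the Hecke operator $$(T_pf)(z)=p^wf(pz)+\sum_{b\in A,\ \deg b<\deg p}f\Bigl(\frac{z+b}{p}\Bigr).$$ Let $1\le l\le q$ and $\nu\ge1$ be integers. For $j\in\{1,l\}$ the series $$f_{j,\nu}(z)=\sum_{c\in A\text{ monic}}c^{jq^\nu}u_c(z)^j$$ converges for every $z\in\Omega$, and $f_{j,\nu}$ is a Drinfeld modular form of weight $jq^\nu+j$ and type $j$ and an eigenform. Moreover $$f_{1,\nu}^{\,l}=f_{l,\nu}.$$ -/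

import Mathlib

open Polynomial

noncomputable section

namespace Drinfeld

/-! Throughout, `F` is a finite field with `q = Fintype.card F` elements, `A = F[X]` (the variable
`X` is `θ`) and `K = RatFunc F` is its field of fractions. -/

section Fields

variable (F : Type*) [Field F] [Fintype F]

theorem one_lt_q : (1 : ℝ) < (Fintype.card F : ℝ) := by
  exact_mod_cast Fintype.one_lt_card

/-- The value `|x| = q ^ deg x` (and `|0| = 0`) on `K`. -/
def absInftyFun (x : RatFunc F) : ℝ :=
  open Classical in if x = 0 then 0 else (Fintype.card F : ℝ) ^ x.intDegree

theorem absInftyFun_nonneg (x : RatFunc F) : 0 ≤ absInftyFun F x := by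
  unfold absInftyFun
  split_ifs
  · exact le_rfl
  · positivity

theorem absInftyFun_eq_zero (x : RatFunc F) : absInftyFun F x = 0 ↔ x = 0 := by
  unfold absInftyFun
  have hq : (Fintype.card F : ℝ) ≠ 0 := (zero_lt_one.trans (one_lt_q F)).ne'
  split_ifs with h
  · simp [h]
  · simpa [h] using zpow_ne_zero _ hq

theorem absInftyFun_mul (x y : RatFunc F) :
    absInftyFun F (x * y) = absInftyFun F x * absInftyFun F y := by
  unfold absInftyFun
  have hq : (Fintype.card F : ℝ) ≠ 0 := (zero_lt_one.trans (one_lt_q F)).ne'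
  by_cases hx : x = 0
  · simp [hx]
  by_cases hy : y = 0
  · simp [hy]
  simp [hx, hy, RatFunc.intDegree_mul hx hy, zpow_add₀ hq]

theorem absInftyFun_add_le_max (x y : RatFunc F) :
    absInftyFun F (x + y) ≤ max (absInftyFun F x) (absInftyFun F y) := by
  by_cases hx : x = 0
  · simp [hx]
  by_cases hy : y = 0
  · simp [hy]
  by_cases hxy : x + y = 0
  · rw [hxy, (absInftyFun_eq_zero F 0).2 rfl]
    exact le_max_of_le_left (absInftyFun_nonneg F x)
  simp only [absInftyFun, hx, hy, hxy, if_false]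
  rcases le_max_iff.1 (RatFunc.intDegree_add_le hy hxy) with h | h
  · exact le_max_of_le_left (zpow_le_zpow_right₀ (one_lt_q F).le h)
  · exact le_max_of_le_right (zpow_le_zpow_right₀ (one_lt_q F).le h)

/-- The absolute value of `K` at infinity, `|a| = q ^ deg a` for `a ∈ A`. -/
def absInfty : AbsoluteValue (RatFunc F) ℝ where
  toFun := absInftyFun F
  map_mul' := absInftyFun_mul F
  nonneg' := absInftyFun_nonneg F
  eq_zero' := absInftyFun_eq_zero F
  add_le' x y := (absInftyFun_add_le_max F x y).trans
    (max_le_add_of_nonneg (absInftyFun_nonneg F x) (absInftyFun_nonneg F y))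

/-- `K_∞`, the completion of `K` with respect to the absolute value at infinity. -/
abbrev KInf : Type _ := (absInfty F).Completion

instance KInf.isUltrametricDist : IsUltrametricDist (KInf F) := by
  refine IsUltrametricDist.isUltrametricDist_of_forall_norm_add_le_max_norm fun x y => ?_
  refine UniformSpace.Completion.induction_on₂ x y ?_ ?_
  · exact isClosed_le (by fun_prop) (by fun_prop)
  · intro a b
    rw [← UniformSpace.Completion.coe_add]
    simp only [UniformSpace.Completion.norm_coe]
    exact absInftyFun_add_le_max F a.ofAbs b.ofAbs

instance KInf.nontriviallyNormedField : NontriviallyNormedField (KInf F) where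
  non_trivial := by
    refine ⟨((WithAbs.toAbs (absInfty F) RatFunc.X : WithAbs (absInfty F)) : KInf F), ?_⟩
    rw [UniformSpace.Completion.norm_coe]
    change 1 < absInftyFun F RatFunc.X
    simpa [absInftyFun, RatFunc.X_ne_zero] using one_lt_q F

/-- An algebraic closure of `K_∞`. -/
abbrev KInfAlg : Type _ := AlgebraicClosure (KInf F)

/-- The unique extension of the absolute value of `K_∞` to its algebraic closure. -/
instance KInfAlg.normedField : NormedField (KInfAlg F) :=
  spectralNorm.normedField (KInf F) (KInfAlg F)

/-- `ℂ_∞`, the completion of an algebraic closure of `K_∞`. -/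
abbrev CInf : Type _ := UniformSpace.Completion (KInfAlg F)

/-- The inclusion of `K_∞` in `ℂ_∞`. -/
def ofKInf : KInf F →+* CInf F :=
  UniformSpace.Completion.coeRingHom.comp (algebraMap (KInf F) (KInfAlg F))

/-- The inclusion of `A` in `K_∞`. -/
def polyToKInf : F[X] →+* KInf F :=
  UniformSpace.Completion.coeRingHom.comp
    ((WithAbs.equiv (absInfty F)).symm.toRingHom.comp (algebraMap F[X] (RatFunc F)))

variable {F}

/-- The inclusion of `A` in `ℂ_∞`. -/
def ofPoly : F[X] →+* CInf F := (ofKInf F).comp (polyToKInf F)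

theorem ofPoly_eq (a : F[X]) : ofPoly a = ofKInf F (polyToKInf F a) := rfl

theorem ofPoly_injective : Function.Injective (ofPoly : F[X] → CInf F) := by
  refine (ofKInf F).injective.comp ?_
  refine Function.Injective.comp (g := (UniformSpace.Completion.coeRingHom :
    WithAbs (absInfty F) →+* KInf F)) (RingHom.injective _) ?_
  exact (WithAbs.equiv (absInfty F)).symm.injective.comp (IsFractionRing.injective F[X] (RatFunc F))

end Fields

section UpperHalfPlane

theorem det_ne_zero_of_GL {R : Type*} [Field R] (γ : GL (Fin 2) R[X]) :
    (γ : Matrix (Fin 2) (Fin 2) R[X]).det ≠ 0 :=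
  ((Matrix.isUnit_iff_isUnit_det _).1 γ.isUnit).ne_zero

variable (F : Type*) [Field F] [Fintype F]

/-- The Drinfeld upper half-plane `Ω = ℂ_∞ ∖ K_∞`. -/
abbrev Omega : Type _ := {z : CInf F // z ∉ Set.range (ofKInf F)}

variable {F}

theorem denom_ne_zero {M : Matrix (Fin 2) (Fin 2) F[X]} (hM : M.det ≠ 0) (z : Omega F) :
    ofPoly (M 1 0) * (z : CInf F) + ofPoly (M 1 1) ≠ 0 := by
  intro h
  by_cases hc : M 1 0 = 0
  · have hd : M 1 1 = 0 := ofPoly_injective (by simpa [hc] using h)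
    exact hM (by simp [Matrix.det_fin_two, hc, hd])
  · have hc' : ofPoly (M 1 0) ≠ 0 := fun h0 => hc (ofPoly_injective (by simpa using h0))
    refine z.2 ⟨-polyToKInf F (M 1 1) / polyToKInf F (M 1 0), ?_⟩
    rw [map_div₀, map_neg, ← ofPoly_eq, ← ofPoly_eq, div_eq_iff hc']
    linear_combination -h

/-- The action `z ↦ (a z + b) / (c z + d)` on `Ω` of the `2 × 2` matrices over `A` with nonzero
determinant. -/
def mobius (M : Matrix (Fin 2) (Fin 2) F[X]) (hM : M.det ≠ 0) (z : Omega F) : Omega F :=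
  ⟨(ofPoly (M 0 0) * (z : CInf F) + ofPoly (M 0 1)) /
      (ofPoly (M 1 0) * (z : CInf F) + ofPoly (M 1 1)), by
    rintro ⟨x, hx⟩
    rw [eq_div_iff (denom_ne_zero hM z)] at hx
    by_cases h : polyToKInf F (M 0 0) - x * polyToKInf F (M 1 0) = 0
    · have h1 : ofPoly (M 0 0) = ofKInf F x * ofPoly (M 1 0) := by
        rw [ofPoly_eq, ofPoly_eq, ← map_mul, sub_eq_zero.1 h]
      have h2 : ofPoly (M 0 1) = ofKInf F x * ofPoly (M 1 1) := by
        rw [h1] at hx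
        linear_combination -hx
      refine hM (ofPoly_injective ?_)
      rw [Matrix.det_fin_two, map_sub, map_mul, map_mul, map_zero, h1, h2]
      ring
    · refine z.2 ⟨(x * polyToKInf F (M 1 1) - polyToKInf F (M 0 1)) /
        (polyToKInf F (M 0 0) - x * polyToKInf F (M 1 0)), ?_⟩
      have h' : ofKInf F (polyToKInf F (M 0 0) - x * polyToKInf F (M 1 0)) ≠ 0 := by
        simpa only [ne_eq, map_eq_zero] using h
      rw [map_div₀, div_eq_iff h']
      simp only [map_sub, map_mul, ← ofPoly_eq]
      linear_combination hx⟩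

/-- The imaginary distance `|z|_i = inf_{x ∈ K_∞} |z - x|`. -/
def imDist (z : CInf F) : ℝ := Metric.infDist z (Set.range (ofKInf F))

variable (F) in
/-- The standard exhaustion of `Ω` by the affinoids
`Ω_n = {z : |z| ≤ q ^ n, |z|_i ≥ q ^ (-n)}`, `n ≥ 0`. Each `Ω_n` is a closed disc from which
finitely many open discs are removed. -/
def affinoid (n : ℕ) : Set (Omega F) :=
  {z | ‖(z : CInf F)‖ ≤ (Fintype.card F : ℝ) ^ n ∧
    ((Fintype.card F : ℝ) ^ n)⁻¹ ≤ imDist (z : CInf F)}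

/-- A function on `Ω` is rigid-analytic if on each `Ω_n` it is a uniform limit of rational
functions without poles in `Ω_n`. -/
def IsRigidAnalytic (f : Omega F → CInf F) : Prop :=
  ∀ n : ℕ, ∀ ε : ℝ, 0 < ε → ∃ P Q : (CInf F)[X],
    ∀ z ∈ affinoid F n, Q.eval (z : CInf F) ≠ 0 ∧
      ‖f z - P.eval (z : CInf F) / Q.eval (z : CInf F)‖ ≤ ε

end UpperHalfPlane

section ModularForms

variable {F : Type*} [Field F] [Fintype F]

/-- The exponential function `e_{ϖ A}(ζ) = ζ ∏_{a ∈ A ∖ {0}} (1 - ζ / (ϖ a))` of the lattice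
`ϖ A`, for `ϖ ≠ 0`. -/
def latticeExp (ϖ ζ : CInf F) : CInf F :=
  ζ * ∏' a : {a : F[X] // a ≠ 0}, (1 - ζ / (ϖ * ofPoly (a : F[X])))

/-- `ϖ A` is the lattice of the Carlitz module `θ ↦ θ τ⁰ + τ`, `τ` being the `q`-th power map:
`e_{ϖ A}(θ ζ) = θ e_{ϖ A}(ζ) + e_{ϖ A}(ζ) ^ q`. -/
def IsCarlitzPeriod (ϖ : CInf F) : Prop :=
  ϖ ≠ 0 ∧ ∀ ζ : CInf F, latticeExp ϖ (ofPoly X * ζ) =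
    ofPoly X * latticeExp ϖ ζ + latticeExp ϖ ζ ^ Fintype.card F

/-- The uniformizer at infinity `u(z) = 1 / e_{ϖ A}(ϖ z)`. -/
def unif (ϖ z : CInf F) : CInf F := (latticeExp ϖ (ϖ * z))⁻¹

/-- `f` has an integral `u`-expansion: `f = ∑_{n ≥ 0} a_n u ^ n` for `|z|_i` large. -/
def HasIntegralUExpansion (ϖ : CInf F) (f : Omega F → CInf F) : Prop :=
  ∃ a : ℕ → CInf F, ∃ δ : ℝ, 0 < δ ∧ ∀ z : Omega F, δ < imDist (z : CInf F) →
    HasSum (fun n : ℕ => a n * unif ϖ (z : CInf F) ^ n) (f z)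

/-- Drinfeld modular forms of weight `w` and type `m` for `Γ = GL₂(A)`. -/
structure IsDrinfeldModularForm (ϖ : CInf F) (w m : ℤ) (f : Omega F → CInf F) : Prop where
  rigidAnalytic : IsRigidAnalytic f
  transform : ∀ (γ : GL (Fin 2) F[X]) (z : Omega F),
    f (mobius (γ : Matrix (Fin 2) (Fin 2) F[X]) (det_ne_zero_of_GL γ) z) =
      (ofPoly (γ 1 0) * (z : CInf F) + ofPoly (γ 1 1)) ^ w *
        ofPoly (γ : Matrix (Fin 2) (Fin 2) F[X]).det ^ (-m) * f z
  uExpansion : HasIntegralUExpansion ϖ f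

/-- The Hecke operator attached to `p ∈ A ∖ {0}` (used for `p` monic irreducible) in weight `w`:
`(T_p f)(z) = p ^ w f(p z) + ∑_{b ∈ A, deg b < deg p} f((z + b) / p)`. -/
def hecke (w : ℤ) (p : F[X]) (hp : p ≠ 0) (f : Omega F → CInf F) (z : Omega F) : CInf F :=
  ofPoly p ^ w * f (mobius !![p, 0; 0, 1] (by simpa [Matrix.det_fin_two] using hp) z) +
    ∑ᶠ b : Polynomial.degreeLT F p.natDegree,
      f (mobius !![1, (b : F[X]); 0, p] (by simpa [Matrix.det_fin_two] using hp) z)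

/-- A Hecke eigenform of weight `w` and type `m`: a nonzero Drinfeld modular form that is an
eigenvector of `T_p` for every monic irreducible `p ∈ A`. -/
structure IsHeckeEigenform (ϖ : CInf F) (w m : ℤ) (f : Omega F → CInf F) : Prop where
  modular : IsDrinfeldModularForm ϖ w m f
  ne_zero : f ≠ 0
  eigen : ∀ (p : F[X]) (hp : p.Monic), Irreducible p →
    ∃ c : CInf F, ∀ z : Omega F, hecke w p hp.ne_zero f z = c * f z

/-- The term `c ^ (l q ^ ν) u_c ^ l`, `u_c = u(c z)`, of the `A`-expansion of `f_{l,ν}`. -/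
def aTerm (ϖ : CInf F) (l ν : ℕ) (z : Omega F) (c : {c : F[X] // c.Monic}) : CInf F :=
  ofPoly (c : F[X]) ^ (l * Fintype.card F ^ ν) *
    unif ϖ (ofPoly (c : F[X]) * (z : CInf F)) ^ l

/-- `f_{l,ν} = ∑_{c ∈ A monic} c ^ (l q ^ ν) u_c ^ l`. -/
def aForm (ϖ : CInf F) (l ν : ℕ) (z : Omega F) : CInf F :=
  ∑' c : {c : F[X] // c.Monic}, aTerm ϖ l ν z c

end ModularForms

end Drinfeld

end

open Polynomial

noncomputable section

namespace Drinfeld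

section FiniteFieldSums

variable {F : Type*} [Field F] [Fintype F] {K : Type*} [Field K] (j : F →+* K)

local notation "q" => Fintype.card F

theorem add_pow_card (j : F →+* K) (x y : K) : (x + y) ^ q = x ^ q + y ^ q := by
  let := j.toAlgebra
  exact map_add (FiniteField.frobeniusAlgHom F K) x y

theorem add_pow_card_pow (j : F →+* K) (n : ℕ) (x y : K) :
    (x + y) ^ q ^ n = x ^ q ^ n + y ^ q ^ n := by
  induction n with
  | zero => simp
  | succ n ih => rw [pow_succ, pow_mul, ih, add_pow_card j, ← pow_mul, ← pow_mul]

theorem map_pow_card (ε : F) : j ε ^ q = j ε := by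
  rw [← map_pow, FiniteField.pow_card]

theorem map_pow_card_pow (n : ℕ) (ε : F) : j ε ^ q ^ n = j ε := by
  rw [← map_pow, FiniteField.pow_card_pow]

theorem card_cast_eq_zero (j : F →+* K) : (q : K) = 0 := by
  rw [← map_natCast j, FiniteField.cast_card_eq_zero, map_zero]

theorem sum_map_pow_lt {i : ℕ} (hi : i < q - 1) : ∑ ε : F, j ε ^ i = 0 := by
  simp_rw [← map_pow, ← map_sum, FiniteField.sum_pow_lt_card_sub_one F i hi, map_zero]

theorem sum_map_pow_card_sub_one : ∑ ε : F, j ε ^ (q - 1) = -1 := by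
  classical
  have hq : 1 < q := Fintype.one_lt_card
  have h : ∀ ε : F, ε ^ (q - 1) = 1 - if ε = 0 then 1 else 0 := by
    intro ε
    split_ifs with h
    · rw [h, zero_pow (by omega), sub_self]
    · rw [FiniteField.pow_card_sub_one_eq_one ε h, sub_zero]
  simp_rw [← map_pow, ← map_sum, h]
  rw [Finset.sum_sub_distrib]
  simp

theorem sum_add_map_pow_lt (t : K) {k : ℕ} (hk : k < q - 1) : ∑ ε : F, (t + j ε) ^ k = 0 := by
  simp_rw [add_pow]
  rw [Finset.sum_comm]
  refine Finset.sum_eq_zero fun i hi => ?_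
  rw [← Finset.sum_mul, ← Finset.mul_sum, sum_map_pow_lt j (by omega)]
  simp

theorem sum_add_map_pow_card_sub_one (t : K) : ∑ ε : F, (t + j ε) ^ (q - 1) = -1 := by
  have hq : 1 < q := Fintype.one_lt_card
  simp_rw [add_comm t, add_pow]
  rw [Finset.sum_comm, Finset.sum_range_succ, Finset.sum_eq_zero, zero_add]
  · simpa using sum_map_pow_card_sub_one j
  · intro i hi
    rw [← Finset.sum_mul, ← Finset.sum_mul, sum_map_pow_lt j (by simpa using hi)]
    simp

theorem prod_add_map (t : K) : ∏ ε : F, (t + j ε) = t ^ q - t := by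
  have h2 : (X ^ q - X : F[X]) = ∏ ε : F, (X - C ε) := by
    have hm : (X ^ q - X : F[X]).Monic := monic_X_pow_sub (by
      rw [degree_X]; exact_mod_cast Fintype.one_lt_card)
    have hd : Multiset.card (X ^ q - X : F[X]).roots = (X ^ q - X : F[X]).natDegree := by
      rw [FiniteField.roots_X_pow_card_sub_X,
        FiniteField.X_pow_card_sub_X_natDegree_eq F Fintype.one_lt_card]
      rfl
    rw [← prod_multiset_X_sub_C_of_monic_of_roots_card_eq hm hd,
      FiniteField.roots_X_pow_card_sub_X]
    rfl
  have h3 := congrArg (eval₂ j t) h2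
  rw [eval₂_finsetProd] at h3
  simp only [eval₂_sub, eval₂_pow, eval₂_X, eval₂_C] at h3
  rw [h3, ← Equiv.prod_comp (Equiv.neg F)]
  simp [sub_eq_add_neg]

theorem pow_card_sub_self_add (t : K) (ε : F) : (t + j ε) ^ q - (t + j ε) = t ^ q - t := by
  rw [add_pow_card j, map_pow_card]
  ring

theorem sum_inv_pow {t : K} (ht : ∀ ε : F, t + j ε ≠ 0) {k : ℕ} (hk : 1 ≤ k) (hkq : k ≤ q) :
    ∑ ε : F, ((t + j ε)⁻¹) ^ k = ((t - t ^ q)⁻¹) ^ k := by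
  have hq : 1 < q := Fintype.one_lt_card
  have hM : t ^ q - t ≠ 0 := by
    rw [← prod_add_map j]
    exact Finset.prod_ne_zero_iff.2 fun ε _ => ht ε
  have key : ∀ (ε : F) (k : ℕ), (t ^ q - t) * ((t + j ε)⁻¹) ^ (k + 1) =
      (t + j ε) ^ (q - 1) * ((t + j ε)⁻¹) ^ k - ((t + j ε)⁻¹) ^ k := by
    intro ε k
    rw [← pow_card_sub_self_add j t ε]
    obtain ⟨m, hm⟩ : ∃ m, q = m + 1 := ⟨q - 1, by omega⟩
    have := ht ε
    rw [hm]
    simp only [Nat.add_sub_cancel]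
    rw [inv_pow, inv_pow, pow_succ, pow_succ]
    field_simp
  induction k, hk using Nat.le_induction with
  | base =>
    apply mul_left_cancel₀ hM
    rw [Finset.mul_sum, Finset.sum_congr rfl fun ε _ => key ε 0]
    simp only [pow_zero, mul_one]
    rw [Finset.sum_sub_distrib, sum_add_map_pow_card_sub_one, pow_one, ← neg_sub (t ^ q) t,
      inv_neg, mul_neg, mul_inv_cancel₀ hM]
    simp [card_cast_eq_zero j]
  | succ k hk ih =>
    apply mul_left_cancel₀ hM
    rw [Finset.mul_sum, Finset.sum_congr rfl fun ε _ => key ε k, Finset.sum_sub_distrib,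
      ih (by omega), Finset.sum_congr rfl (g := fun ε => (t + j ε) ^ (q - 1 - k)),
      sum_add_map_pow_lt j t (by omega), zero_sub, pow_succ, mul_left_comm, ← neg_sub (t ^ q) t, inv_neg,
      mul_neg, mul_inv_cancel₀ hM, mul_neg_one]
    intro ε _
    rw [inv_pow, ← div_eq_mul_inv, div_eq_iff (pow_ne_zero _ (ht ε)), ← pow_add]
    congr 1
    omega

theorem sum_inv_pow_mul {y w : K} (hw : w ≠ 0) (hy : ∀ ε : F, y + j ε * w ≠ 0) {k : ℕ}
    (hk : 1 ≤ k) (hkq : k ≤ q) :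
    ∑ ε : F, ((y + j ε * w)⁻¹) ^ k = (w ^ (q - 1) * (w ^ (q - 1) * y - y ^ q)⁻¹) ^ k := by
  have hq : 1 < q := Fintype.one_lt_card
  have h : ∀ ε : F, y + j ε * w = (y / w + j ε) * w := by
    intro ε
    field_simp
  have ht : ∀ ε : F, y / w + j ε ≠ 0 := fun ε h0 => hy ε (by rw [h, h0, zero_mul])
  simp_rw [h, mul_inv, mul_pow _ (w⁻¹)]
  rw [← Finset.sum_mul, sum_inv_pow j ht hk hkq, ← mul_pow]
  congr 1
  obtain ⟨m, hm⟩ : ∃ m, q = m + 1 := ⟨q - 1, by omega⟩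
  rw [hm, Nat.add_sub_cancel]
  have : w ^ m * y - y ^ (m + 1) = (y / w - (y / w) ^ (m + 1)) * w ^ (m + 1) := by
    rw [div_pow]
    field_simp
    ring
  rw [this, mul_inv, pow_succ w]
  field_simp

theorem prod_add_map_mul (y w : K) : ∏ ε : F, (y + j ε * w) = y ^ q - w ^ (q - 1) * y := by
  have hq : 1 < q := Fintype.one_lt_card
  by_cases hw : w = 0
  · simp [hw, zero_pow (show q - 1 ≠ 0 by omega)]
  have h : ∀ ε : F, y + j ε * w = (y / w + j ε) * w := by
    intro ε
    field_simp
  simp_rw [h]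
  rw [Finset.prod_mul_distrib, prod_add_map, Finset.prod_const, Finset.card_univ]
  obtain ⟨m, hm⟩ : ∃ m, q = m + 1 := ⟨q - 1, by omega⟩
  rw [hm, Nat.add_sub_cancel, div_pow]
  field_simp
  ring

end FiniteFieldSums

section DegreeLT

variable (F : Type*) [Field F] [Fintype F]

local notation "q" => Fintype.card F

theorem finite_degree_lt (N : ℕ) : {a : F[X] | a.degree < N}.Finite := by
  have h : Finite (degreeLT F N) := Finite.of_equiv _ (degreeLTEquiv F N).symm.toEquiv
  refine (Set.toFinite (degreeLT F N : Set F[X])).subset fun a ha => ?_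
  exact mem_degreeLT.2 ha

/-- The polynomials of degree less than `N`. -/
def degLT (N : ℕ) : Finset F[X] := (finite_degree_lt F N).toFinset

variable {F}

theorem mem_degLT {N : ℕ} {a : F[X]} : a ∈ degLT F N ↔ a.degree < N := by
  simp [degLT]

theorem zero_mem_degLT (N : ℕ) : (0 : F[X]) ∈ degLT F N := by
  simp [mem_degLT]

theorem add_mem_degLT {N : ℕ} {a b : F[X]} (ha : a ∈ degLT F N) (hb : b ∈ degLT F N) :
    a + b ∈ degLT F N :=
  mem_degLT.2 ((degree_add_le a b).trans_lt (max_lt (mem_degLT.1 ha) (mem_degLT.1 hb)))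

theorem neg_mem_degLT {N : ℕ} {a : F[X]} (ha : a ∈ degLT F N) : -a ∈ degLT F N := by
  rw [mem_degLT, degree_neg]
  exact mem_degLT.1 ha

theorem degLT_mono {M N : ℕ} (h : M ≤ N) : degLT F M ⊆ degLT F N := fun _ ha =>
  mem_degLT.2 ((mem_degLT.1 ha).trans_le (by exact_mod_cast h))

theorem mem_degLT_of_natDegree_lt {N : ℕ} {a : F[X]} (h : a.natDegree < N) : a ∈ degLT F N :=
  mem_degLT.2 (degree_le_natDegree.trans_lt (by exact_mod_cast h))

theorem natDegree_lt_of_mem_degLT {N : ℕ} {a : F[X]} (h : a ∈ degLT F N) (ha : a ≠ 0) :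
    a.natDegree < N :=
  (natDegree_lt_iff_degree_lt ha).2 (mem_degLT.1 h)

theorem degLT_zero : degLT F 0 = {0} := by
  ext a
  rw [mem_degLT, Finset.mem_singleton]
  constructor
  · intro h
    by_contra ha
    rw [degree_eq_natDegree ha] at h
    exact absurd h (by simp)
  · rintro rfl
    simp

theorem prod_degLT_succ {M : Type*} [CommMonoid M] (N : ℕ) (g : F[X] → M) :
    ∏ a ∈ degLT F (N + 1), g a = ∏ ε : F, ∏ a ∈ degLT F N, g (a + C ε * X ^ N) := by
  rw [← Finset.prod_product']
  symm
  refine Finset.prod_bij (fun x _ => x.2 + C x.1 * X ^ N) ?_ ?_ ?_ ?_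
  · rintro ⟨ε, a⟩ h
    have ha := mem_degLT.1 (Finset.mem_product.1 h).2
    refine mem_degLT.2 ((degree_add_le _ _).trans_lt (max_lt (ha.trans ?_) ?_))
    · exact_mod_cast Nat.lt_succ_self N
    · exact (degree_C_mul_X_pow_le N ε).trans_lt (by exact_mod_cast Nat.lt_succ_self N)
  · rintro ⟨ε, a⟩ h ⟨ε', a'⟩ h' heq
    have ha := mem_degLT.1 (Finset.mem_product.1 h).2
    have ha' := mem_degLT.1 (Finset.mem_product.1 h').2
    have h1 := congrArg (fun p => coeff p N) heq
    simp only [coeff_add, coeff_C_mul, coeff_X_pow, if_true, mul_one,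
      coeff_eq_zero_of_degree_lt ha, coeff_eq_zero_of_degree_lt ha', zero_add] at h1
    simp only at heq
    subst h1
    simpa using heq
  · intro b hb
    have hb := mem_degLT.1 hb
    refine ⟨(b.coeff N, b - C (b.coeff N) * X ^ N), ?_, by simp⟩
    refine Finset.mem_product.2 ⟨Finset.mem_univ _, mem_degLT.2 ?_⟩
    rw [degree_lt_iff_coeff_zero]
    intro m hm
    rw [coeff_sub, coeff_C_mul, coeff_X_pow]
    rcases hm.eq_or_lt with h | h
    · simp [h]
    · rw [if_neg h.ne', mul_zero, sub_zero]
      exact coeff_eq_zero_of_degree_lt (hb.trans_le (by exact_mod_cast h))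
  · simp

theorem sum_degLT_succ {M : Type*} [AddCommMonoid M] (N : ℕ) (g : F[X] → M) :
    ∑ a ∈ degLT F (N + 1), g a = ∑ ε : F, ∑ a ∈ degLT F N, g (a + C ε * X ^ N) :=
  prod_degLT_succ (M := Multiplicative M) N g

@[to_additive]
theorem prod_degLT_neg {M : Type*} [CommMonoid M] (N : ℕ) (g : F[X] → M) :
    ∏ a ∈ degLT F N, g (-a) = ∏ a ∈ degLT F N, g a :=
  Finset.prod_bij' (fun a _ => -a) (fun a _ => -a) (fun a ha => neg_mem_degLT ha)
    (fun a ha => neg_mem_degLT ha) (by simp) (by simp) (by simp)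

theorem card_degLT (N : ℕ) : (degLT F N).card = q ^ N := by
  induction N with
  | zero => simp [degLT_zero]
  | succ N ih =>
    have := sum_degLT_succ (F := F) N (fun _ => 1)
    simp only [Finset.sum_const, smul_eq_mul, mul_one, Finset.card_univ, ih] at this
    rw [this, pow_succ']

end DegreeLT

section LatticePolynomials

variable {F : Type*} [Field F] [Fintype F] {K : Type*} [Field K] (ι : F[X] →+* K)

local notation "q" => Fintype.card F

/-- The polynomial function `∏ (x + a)` over the `a ∈ A` with `deg a < N`. -/
def latProd (N : ℕ) (x : K) : K := ∏ a ∈ degLT F N, (x + ι a)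

theorem latProd_zero (x : K) : latProd ι 0 x = x := by
  simp [latProd, degLT_zero]

theorem latProd_succ_eq_prod (N : ℕ) (x : K) :
    latProd ι (N + 1) x = ∏ ε : F, latProd ι N (x + ι (C ε) * ι X ^ N) := by
  rw [latProd, prod_degLT_succ]
  refine Finset.prod_congr rfl fun ε _ => Finset.prod_congr rfl fun a _ => ?_
  rw [map_add, map_mul, map_pow]
  ring

theorem latProd_add_and_map_mul (N : ℕ) :
    (∀ x y, latProd ι N (x + y) = latProd ι N x + latProd ι N y) ∧
      ∀ (ε : F) x, latProd ι N (ι (C ε) * x) = ι (C ε) * latProd ι N x := by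
  induction N with
  | zero => simp [latProd_zero]
  | succ N ih =>
    have h : ∀ x, latProd ι (N + 1) x =
        latProd ι N x ^ q - latProd ι N (ι X ^ N) ^ (q - 1) * latProd ι N x := by
      intro x
      rw [latProd_succ_eq_prod, ← prod_add_map_mul (ι.comp C)]
      simp_rw [ih.1, ih.2]
      rfl
    constructor
    · intro x y
      rw [h, h, h, ih.1, add_pow_card (ι.comp C)]
      ring
    · intro ε x
      have := map_pow_card (ι.comp C) ε
      simp only [RingHom.comp_apply] at this
      rw [h, h, ih.2, mul_pow, this]
      ring

theorem latProd_add (N : ℕ) (x y : K) :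
    latProd ι N (x + y) = latProd ι N x + latProd ι N y :=
  (latProd_add_and_map_mul ι N).1 x y

theorem latProd_map_mul (N : ℕ) (ε : F) (x : K) :
    latProd ι N (ι (C ε) * x) = ι (C ε) * latProd ι N x :=
  (latProd_add_and_map_mul ι N).2 ε x

theorem latProd_succ (N : ℕ) (x : K) : latProd ι (N + 1) x =
    latProd ι N x ^ q - latProd ι N (ι X ^ N) ^ (q - 1) * latProd ι N x := by
  rw [latProd_succ_eq_prod, ← prod_add_map_mul (ι.comp C)]
  simp_rw [latProd_add, latProd_map_mul]
  rfl

theorem latProd_map_eq_zero {N : ℕ} {a : F[X]} (ha : a ∈ degLT F N) : latProd ι N (ι a) = 0 :=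
  Finset.prod_eq_zero (neg_mem_degLT ha) (by simp)

/-- The product of the nonzero `a ∈ A` with `deg a < N`. -/
def latConst (N : ℕ) : K := open Classical in ∏ a ∈ (degLT F N).erase 0, ι a

/-- The normalized polynomial `x ∏ (1 + x / a)` over the nonzero `a ∈ A` with `deg a < N`. -/
def latExp (N : ℕ) (x : K) : K := latProd ι N x / latConst ι N

theorem latExp_add (N : ℕ) (x y : K) : latExp ι N (x + y) = latExp ι N x + latExp ι N y := by
  rw [latExp, latProd_add, add_div, ← latExp, ← latExp]

theorem latExp_map_mul (N : ℕ) (ε : F) (x : K) :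
    latExp ι N (ι (C ε) * x) = ι (C ε) * latExp ι N x := by
  rw [latExp, latProd_map_mul, mul_div_assoc, ← latExp]

theorem latExp_map_eq_zero {N : ℕ} {a : F[X]} (ha : a ∈ degLT F N) : latExp ι N (ι a) = 0 := by
  rw [latExp, latProd_map_eq_zero ι ha, zero_div]

variable {ι}

theorem latExp_eq (hι : Function.Injective ι) (N : ℕ) (x : K) : latExp ι N x = open Classical in
    x * ∏ a ∈ (degLT F N).erase 0, (1 - x / ι a) := by
  classical
  have h : latProd ι N x = x * ∏ a ∈ (degLT F N).erase 0, (x - ι a) := by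
    rw [latProd, ← prod_degLT_neg, ← Finset.mul_prod_erase _ _ (zero_mem_degLT N)]
    simp [sub_eq_add_neg]
  have h2 : latConst ι N = ∏ a ∈ (degLT F N).erase 0, -ι a := by
    rw [latConst]
    refine Finset.prod_bij' (fun a _ => -a) (fun a _ => -a) ?_ ?_ ?_ ?_ ?_
    · intro a ha
      simp only [Finset.mem_erase, ne_eq, neg_eq_zero] at ha ⊢
      exact ⟨ha.1, neg_mem_degLT ha.2⟩
    · intro a ha
      simp only [Finset.mem_erase, ne_eq, neg_eq_zero] at ha ⊢
      exact ⟨ha.1, neg_mem_degLT ha.2⟩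
    all_goals simp
  rw [latExp, h, h2, mul_div_assoc, ← Finset.prod_div_distrib]
  congr 1
  refine Finset.prod_congr rfl fun a ha => ?_
  have : ι a ≠ 0 := by
    rw [ne_eq, map_eq_zero_iff ι hι]
    exact (Finset.mem_erase.1 ha).1
  field_simp
  ring

theorem prod_erase_zero : open Classical in ∏ ε ∈ (Finset.univ : Finset F).erase 0, ε = -1 := by
  classical
  have h := congrArg Units.val (FiniteField.prod_univ_units_id_eq_neg_one (K := F))
  rw [Units.coe_prod, Units.val_neg, Units.val_one] at h
  rw [← h]
  symm
  refine Finset.prod_bij (fun u _ => (u : F)) (by simp) ?_ ?_ (by simp)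
  · intro a _ b _ hab
    exact Units.ext hab
  · intro b hb
    exact ⟨Units.mk0 b (Finset.mem_erase.1 hb).1, by simp⟩

theorem latConst_succ (N : ℕ) :
    latConst ι (N + 1) = -(latProd ι N (ι X ^ N) ^ (q - 1)) * latConst ι N := by
  classical
  have h : ∀ M, latConst ι M = ∏ a ∈ degLT F M, if a = 0 then 1 else ι a := by
    intro M
    rw [← Finset.mul_prod_erase _ _ (zero_mem_degLT M), latConst, if_pos rfl, one_mul]
    exact Finset.prod_congr rfl fun a ha => by rw [if_neg (Finset.mem_erase.1 ha).1]
  rw [h, prod_degLT_succ, ← Finset.mul_prod_erase _ _ (Finset.mem_univ 0), mul_comm]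
  congr 1
  · have h2 : ∀ ε ∈ (Finset.univ : Finset F).erase 0,
        (∏ a ∈ degLT F N, if a + C ε * X ^ N = 0 then 1 else ι (a + C ε * X ^ N)) =
          ι (C ε) * latProd ι N (ι X ^ N) := by
      intro ε hε
      rw [← latProd_map_mul, latProd]
      refine Finset.prod_congr rfl fun a ha => ?_
      rw [if_neg, map_add, map_mul, map_pow, add_comm]
      intro h0
      have := congrArg (fun p => coeff p N) h0
      simp [coeff_eq_zero_of_degree_lt (mem_degLT.1 ha), (Finset.mem_erase.1 hε).1] at this
    rw [Finset.prod_congr rfl h2, Finset.prod_mul_distrib, Finset.prod_const,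
      Finset.card_erase_of_mem (Finset.mem_univ _), Finset.card_univ, ← map_prod, ← map_prod,
      prod_erase_zero]
    simp
  · rw [h]
    simp

theorem latProd_X_pow_ne_zero (hι : Function.Injective ι) (N : ℕ) : latProd ι N (ι X ^ N) ≠ 0 := by
  refine Finset.prod_ne_zero_iff.2 fun a ha h0 => ?_
  rw [← map_pow, ← map_add, map_eq_zero_iff ι hι] at h0
  have := congrArg (fun p => coeff p N) h0
  simp [coeff_eq_zero_of_degree_lt (mem_degLT.1 ha)] at this

/-- `∑ (x + a) ^ (-k) = e_N(x) ^ (-k)` for `1 ≤ k ≤ q`, the sum being over `deg a < N`. -/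
theorem sum_inv_pow_degLT (hι : Function.Injective ι) {N : ℕ} {x : K}
    (hx : ∀ a ∈ degLT F N, x + ι a ≠ 0) {k : ℕ}
    (hk : 1 ≤ k) (hkq : k ≤ q) :
    ∑ a ∈ degLT F N, ((x + ι a)⁻¹) ^ k = ((latExp ι N x)⁻¹) ^ k := by
  induction N generalizing x with
  | zero => simp [degLT_zero, latExp, latProd_zero, latConst]
  | succ N ih =>
    have hw := latProd_X_pow_ne_zero hι N
    have hx' : ∀ (ε : F), ∀ a ∈ degLT F N, x + ι (C ε) * ι X ^ N + ι a ≠ 0 := by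
      intro ε a ha
      have := hx (a + C ε * X ^ N) ?_
      · rw [map_add, map_mul, map_pow] at this
        convert this using 1
        ring
      · refine mem_degLT.2 ((degree_add_le _ _).trans_lt (max_lt ((mem_degLT.1 ha).trans ?_) ?_))
        · exact_mod_cast Nat.lt_succ_self N
        · exact (degree_C_mul_X_pow_le N ε).trans_lt (by exact_mod_cast Nat.lt_succ_self N)
    have hy : ∀ ε : F, latProd ι N x + (ι.comp C) ε * latProd ι N (ι X ^ N) ≠ 0 := by
      intro ε
      rw [RingHom.comp_apply, ← latProd_map_mul, ← latProd_add]
      exact Finset.prod_ne_zero_iff.2 (hx' ε)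
    have hstep : ∀ ε : F, ∑ a ∈ degLT F N, ((x + ι (a + C ε * X ^ N))⁻¹) ^ k =
        latConst ι N ^ k * ((latProd ι N x + (ι.comp C) ε * latProd ι N (ι X ^ N))⁻¹) ^ k := by
      intro ε
      have := ih (hx' ε)
      rw [latExp, latProd_add, latProd_map_mul, inv_div, div_eq_mul_inv, mul_pow] at this
      rw [RingHom.comp_apply, ← this]
      refine Finset.sum_congr rfl fun a _ => ?_
      rw [map_add, map_mul, map_pow]
      congr 2
      ring
    rw [sum_degLT_succ, Finset.sum_congr rfl fun ε _ => hstep ε, ← Finset.mul_sum,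
      sum_inv_pow_mul (ι.comp C) hw hy hk hkq, ← mul_pow, latExp, latProd_succ, latConst_succ]
    congr 1
    rw [inv_div, div_eq_mul_inv, ← neg_sub (latProd ι N (ι X ^ N) ^ (q - 1) * latProd ι N x),
      inv_neg]
    ring

theorem sum_add_pow_degLT {N k : ℕ} (hk : k < N) (y : K) :
    ∑ a ∈ degLT F N, (y + ι a) ^ k = 0 := by
  induction N generalizing k with
  | zero => omega
  | succ N ih =>
    have h : ∀ ε : F, ∑ a ∈ degLT F N, (y + ι (a + C ε * X ^ N)) ^ k =
        ∑ a ∈ degLT F N, (y + ι a) ^ k := by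
      intro ε
      rw [← sub_eq_zero, ← Finset.sum_sub_distrib]
      have h1 : ∀ a ∈ degLT F N, (y + ι (a + C ε * X ^ N)) ^ k - (y + ι a) ^ k =
          ∑ i ∈ Finset.range k,
            (y + ι a) ^ i * (ι (C ε * X ^ N)) ^ (k - i) * (k.choose i : K) := by
        intro a _
        rw [map_add, ← add_assoc, add_pow, Finset.sum_range_succ]
        simp
      rw [Finset.sum_congr rfl h1, Finset.sum_comm]
      refine Finset.sum_eq_zero fun i hi => ?_
      rw [← Finset.sum_mul, ← Finset.sum_mul, ih (by have := Finset.mem_range.1 hi; omega)]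
      simp
    rw [sum_degLT_succ, Finset.sum_congr rfl fun ε _ => h ε, Finset.sum_const, Finset.card_univ,
      nsmul_eq_mul, card_cast_eq_zero (ι.comp C), zero_mul]

/-- The square sums approximating the `A`-expansion of weight `q ^ ν + 1` transform under
`z ↦ -1 / z` like a modular form. -/
theorem sum_sum_inversion {ν N : ℕ} (hν : 1 ≤ ν) (hN : q ^ ν ≤ N) {z : K} (hz : z ≠ 0) :
    ∑ c ∈ degLT F N, ∑ a ∈ degLT F N, ι c ^ q ^ ν * (ι c * (-1 / z) + ι a)⁻¹ =
      z ^ (q ^ ν + 1) * ∑ c ∈ degLT F N, ∑ a ∈ degLT F N, ι c ^ q ^ ν * (ι c * z + ι a)⁻¹ := by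
  have hq : 1 < q := Fintype.one_lt_card
  have hQ : 1 < q ^ ν := Nat.one_lt_pow (by omega) hq
  rw [Finset.sum_comm, Finset.mul_sum]
  refine Finset.sum_congr rfl fun a _ => ?_
  have h1 : ∀ c ∈ degLT F N, ι c ^ q ^ ν * (ι c * (-1 / z) + ι a)⁻¹ =
      z ^ (q ^ ν + 1) * (ι a ^ q ^ ν * (ι a * z + ι (-c))⁻¹)
        - z * (ι a * z + ι (-c)) ^ (q ^ ν - 1) := by
    intro c _
    have e1 : ι c * (-1 / z) + ι a = (ι a * z - ι c) / z := by field_simp; ring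
    have e2 : ι c ^ q ^ ν = z ^ q ^ ν * ι a ^ q ^ ν - (ι a * z - ι c) ^ q ^ ν := by
      have := add_pow_card_pow (ι.comp C) ν (ι a * z - ι c) (ι c)
      rw [sub_add_cancel, mul_pow] at this
      linear_combination -this
    have e3 : (ι a * z - ι c) ^ q ^ ν * (ι a * z - ι c)⁻¹ = (ι a * z - ι c) ^ (q ^ ν - 1) := by
      by_cases h0 : ι a * z - ι c = 0
      · rw [h0, inv_zero, mul_zero, zero_pow (by omega)]
      · rw [← div_eq_mul_inv, div_eq_iff h0, ← pow_succ]
        congr 1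
        omega
    rw [e1, inv_div, map_neg, ← sub_eq_add_neg, ← e3, e2]
    ring
  rw [Finset.sum_congr rfl h1, sum_degLT_neg N fun c => z ^ (q ^ ν + 1) *
    (ι a ^ q ^ ν * (ι a * z + ι c)⁻¹) - z * (ι a * z + ι c) ^ (q ^ ν - 1), Finset.sum_sub_distrib,
    ← Finset.mul_sum _ _ z, sum_add_pow_degLT (by omega), mul_zero, sub_zero, Finset.mul_sum]

end LatticePolynomials

section Monic

variable {F : Type*} [Field F] [Fintype F]

local notation "q" => Fintype.card F

variable (F) in
/-- The monic polynomials of degree less than `N`. -/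
def monicLT (N : ℕ) : Finset F[X] := open Classical in (degLT F N).filter Monic

theorem mem_monicLT {N : ℕ} {c : F[X]} : c ∈ monicLT F N ↔ c.degree < N ∧ c.Monic := by
  simp [monicLT, mem_degLT]

theorem mem_monicLT_iff {N : ℕ} {c : F[X]} : c ∈ monicLT F N ↔ c.natDegree < N ∧ c.Monic := by
  rw [mem_monicLT]
  refine and_congr_left fun h => ?_
  rw [natDegree_lt_iff_degree_lt h.ne_zero]

theorem monicLT_zero : monicLT F 0 = ∅ := by
  ext c
  simp [mem_monicLT_iff]

theorem sum_monicLT_succ {M : Type*} [AddCommMonoid M] (N : ℕ) (g : F[X] → M) :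
    ∑ c ∈ monicLT F (N + 1), g c = g 1 + ∑ c ∈ monicLT F N, ∑ ε : F, g (c * X + C ε) := by
  classical
  have h1 : (1 : F[X]) ∈ monicLT F (N + 1) := mem_monicLT_iff.2 ⟨by simp, monic_one⟩
  rw [← Finset.add_sum_erase _ _ h1, ← Finset.sum_product']
  congr 1
  symm
  have hdeg : ∀ c : F[X], c.Monic → ∀ ε : F, (c * X + C ε).degree = (c * X).degree := by
    intro c hc ε
    refine degree_add_eq_left_of_degree_lt (degree_C_le.trans_lt ?_)
    rw [degree_mul, degree_X, degree_eq_natDegree hc.ne_zero]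
    exact_mod_cast Nat.succ_pos _
  have hmon : ∀ c : F[X], c.Monic → ∀ ε : F, (c * X + C ε).Monic := by
    intro c hc ε
    refine (hc.mul monic_X).add_of_left (degree_C_le.trans_lt ?_)
    rw [degree_mul, degree_X, degree_eq_natDegree hc.ne_zero]
    exact_mod_cast Nat.succ_pos _
  have hnat : ∀ c : F[X], c.Monic → ∀ ε : F, (c * X + C ε).natDegree = c.natDegree + 1 := by
    intro c hc ε
    rw [natDegree_eq_of_degree_eq (hdeg c hc ε), natDegree_mul_X hc.ne_zero]
  refine Finset.sum_bij' (fun x _ => x.1 * X + C x.2) (fun c _ => (c.divX, c.coeff 0)) ?_ ?_ ?_ ?_ ?_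
  · rintro ⟨c, ε⟩ h
    have hc := mem_monicLT_iff.1 (Finset.mem_product.1 h).1
    refine Finset.mem_erase.2 ⟨fun h1 => ?_, mem_monicLT_iff.2 ⟨?_, hmon c hc.2 ε⟩⟩
    · have := hnat c hc.2 ε
      simp only [h1, natDegree_one] at this
      omega
    · have := hnat c hc.2 ε
      have h2 : c.natDegree < N := hc.1
      simp only
      omega
  · intro c hc
    obtain ⟨hc1, hc⟩ := Finset.mem_erase.1 hc
    obtain ⟨hd, hm⟩ := mem_monicLT_iff.1 hc
    have hd0 : c.natDegree ≠ 0 := fun h0 => hc1 (hm.natDegree_eq_zero.1 h0)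
    refine Finset.mem_product.2 ⟨mem_monicLT_iff.2 ⟨?_, ?_⟩, Finset.mem_univ _⟩
    · rw [natDegree_divX_eq_natDegree_tsub_one]
      omega
    · rw [Monic, leadingCoeff, natDegree_divX_eq_natDegree_tsub_one, coeff_divX,
        Nat.sub_add_cancel (by omega)]
      exact hm
  · rintro ⟨c, ε⟩ _
    refine Prod.ext ?_ (by simp)
    ext i
    simp [coeff_divX]
  · intro c _
    simp only
    exact divX_mul_X_add c
  · simp

theorem sum_erase_zero_eq_neg_sum_monicLT {K : Type*} [Field K] (j : F →+* K) (N : ℕ)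
    {h : F[X] → K} (hh : ∀ (ε : F) (c : F[X]), ε ≠ 0 → h (C ε * c) = h c) :
    (open Classical in ∑ c ∈ (degLT F N).erase 0, h c) = -∑ c ∈ monicLT F N, h c := by
  classical
  have h1 : ∑ c ∈ (degLT F N).erase 0, h c =
      ∑ x ∈ (Finset.univ : Finset Fˣ) ×ˢ monicLT F N, h x.2 := by
    symm
    refine Finset.sum_bij' (fun x _ => C (x.1 : F) * x.2)
      (fun c hc => (Units.mk0 c.leadingCoeff (leadingCoeff_ne_zero.2 (Finset.mem_erase.1 hc).1),
        C c.leadingCoeff⁻¹ * c)) ?_ ?_ ?_ ?_ ?_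
    · rintro ⟨u, c⟩ hx
      have hc := mem_monicLT.1 (Finset.mem_product.1 hx).2
      refine Finset.mem_erase.2 ⟨mul_ne_zero (by simp) hc.2.ne_zero, mem_degLT.2 ?_⟩
      rw [degree_C_mul u.ne_zero]
      exact hc.1
    · intro c hc
      obtain ⟨h0, hd⟩ := Finset.mem_erase.1 hc
      refine Finset.mem_product.2 ⟨Finset.mem_univ _, mem_monicLT.2 ⟨?_, ?_⟩⟩
      · rw [degree_C_mul (inv_ne_zero (leadingCoeff_ne_zero.2 h0))]
        exact mem_degLT.1 hd
      · rw [mul_comm]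
        exact monic_mul_leadingCoeff_inv h0
    · rintro ⟨u, c⟩ hx
      have hc := mem_monicLT.1 (Finset.mem_product.1 hx).2
      refine Prod.ext (Units.ext ?_) ?_
      · simp [hc.2.leadingCoeff]
      · simp only [leadingCoeff_mul, leadingCoeff_C, hc.2.leadingCoeff, mul_one]
        rw [← mul_assoc, ← C_mul, inv_mul_cancel₀ u.ne_zero, C_1, one_mul]
    · intro c hc
      simp only [Units.val_mk0]
      rw [← mul_assoc, ← C_mul,
        mul_inv_cancel₀ (leadingCoeff_ne_zero.2 (Finset.mem_erase.1 hc).1), C_1, one_mul]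
    · rintro ⟨u, c⟩ _
      exact (hh u c u.ne_zero).symm
  have hq : ((q - 1 : ℕ) : K) = -1 := by
    rw [Nat.cast_sub Fintype.card_pos, card_cast_eq_zero j]
    simp
  rw [h1, Finset.sum_product]
  simp only
  rw [Finset.sum_const, Finset.card_univ, Fintype.card_units, nsmul_eq_mul,
    hq, neg_one_mul]

/-- For `F`-linear maps `φ`, `ψ` on `A` with `ψ` injective, `l`-th powers with `1 ≤ l ≤ q`
commute with the sum of `φ / ψ` over the monic polynomials of degree less than `N`. -/
theorem sum_monicLT_div_pow {K : Type*} [Field K] (j : F →+* K) (N : ℕ) {φ ψ : F[X] →+ K}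
    (hφ : ∀ ε a, φ (C ε * a) = j ε * φ a) (hψ : ∀ ε a, ψ (C ε * a) = j ε * ψ a)
    (hinj : Function.Injective ψ) {l : ℕ} (hl : 1 ≤ l) (hlq : l ≤ q) :
    ∑ c ∈ monicLT F N, (φ c / ψ c) ^ l = (∑ c ∈ monicLT F N, φ c / ψ c) ^ l := by
  induction N generalizing φ ψ l with
  | zero => simp [monicLT_zero, (show l ≠ 0 by omega)]
  | succ N ih =>
    have hψ0 : ∀ c, c ≠ 0 → ψ c ≠ 0 := fun c hc h0 => hc (hinj (by rw [h0, map_zero]))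
    have hψ1 : ψ 1 ≠ 0 := hψ0 1 one_ne_zero
    have hψC : ∀ ε, ψ (C ε) = j ε * ψ 1 := fun ε => by simpa using hψ ε 1
    have hφC : ∀ ε, φ (C ε) = j ε * φ 1 := fun ε => by simpa using hφ ε 1
    set lam : K := φ 1 / ψ 1 with hlam
    set W : K := ψ 1 ^ (q - 1) with hW
    have hW0 : W ≠ 0 := pow_ne_zero _ hψ1
    -- the induced maps on the quotient by the constants, identified with `A` through `c ↦ c X`
    let φ' : F[X] →+ K :=
      { toFun := fun c => W * (φ (c * X) - lam * ψ (c * X))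
        map_zero' := by simp
        map_add' := fun a b => by simp only [add_mul, map_add]; ring }
    let ψ' : F[X] →+ K :=
      { toFun := fun c => W * ψ (c * X) - ψ (c * X) ^ q
        map_zero' := by simp [Fintype.card_ne_zero]
        map_add' := fun a b => by simp only [add_mul, map_add, add_pow_card j]; ring }
    have hφ' : ∀ ε a, φ' (C ε * a) = j ε * φ' a := by
      intro ε a
      simp only [φ', AddMonoidHom.coe_mk, ZeroHom.coe_mk, mul_assoc, hφ, hψ]
      ring
    have hψ' : ∀ ε a, ψ' (C ε * a) = j ε * ψ' a := by
      intro ε a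
      simp only [ψ', AddMonoidHom.coe_mk, ZeroHom.coe_mk, mul_assoc, hψ, mul_pow, map_pow_card]
      ring
    have hne : ∀ c : F[X], c ≠ 0 → ∀ ε : F, ψ (c * X) + j ε * ψ 1 ≠ 0 := by
      intro c hc ε
      rw [← hψC, ← map_add]
      refine hψ0 _ fun h0 => hc ?_
      ext i
      simpa using congrArg (fun p => coeff p (i + 1)) h0
    have hinj' : Function.Injective ψ' := by
      rw [injective_iff_map_eq_zero]
      intro c h0
      by_contra hc
      have h1 := prod_add_map_mul j (ψ (c * X)) (ψ 1)
      simp only [ψ', AddMonoidHom.coe_mk, ZeroHom.coe_mk] at h0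
      rw [← hW, ← neg_sub, h0, neg_zero] at h1
      exact Finset.prod_ne_zero_iff.2 (fun ε _ => hne c hc ε) h1
    have hfib : ∀ c ∈ monicLT F N, ∀ k, 1 ≤ k → k ≤ q →
        ∑ ε : F, (φ (c * X + C ε) / ψ (c * X + C ε) - lam) ^ k = (φ' c / ψ' c) ^ k := by
      intro c hc k hk hkq
      have hc0 : c ≠ 0 := (mem_monicLT.1 hc).2.ne_zero
      have h1 : ∀ ε : F, (φ (c * X + C ε) / ψ (c * X + C ε) - lam) ^ k =
          (φ (c * X) - lam * ψ (c * X)) ^ k * ((ψ (c * X) + j ε * ψ 1)⁻¹) ^ k := by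
        intro ε
        have := hne c hc0 ε
        rw [← mul_pow, map_add, map_add, hφC, hψC]
        congr 1
        rw [hlam]
        field_simp
        ring
      simp_rw [h1]
      rw [← Finset.mul_sum, sum_inv_pow_mul j hψ1 (hne c hc0) hk hkq, ← mul_pow]
      congr 1
      simp only [φ', ψ', AddMonoidHom.coe_mk, ZeroHom.coe_mk, ← hW]
      ring
    have hshift : ∀ k, 1 ≤ k → k ≤ q →
        ∑ c ∈ monicLT F (N + 1), (φ c / ψ c - lam) ^ k =
          (∑ c ∈ monicLT F N, φ' c / ψ' c) ^ k := by
      intro k hk hkq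
      rw [sum_monicLT_succ, ← hlam, sub_self, zero_pow (by omega), zero_add,
        Finset.sum_congr rfl fun c hc => hfib c hc k hk hkq, ih hφ' hψ' hinj' hk hkq]
    have hcard : ∑ c ∈ monicLT F (N + 1), (1 : K) = 1 := by
      rw [sum_monicLT_succ]
      simp [card_cast_eq_zero j]
    set S := ∑ c ∈ monicLT F N, φ' c / ψ' c
    have hexp : ∀ l, 1 ≤ l → l ≤ q →
        ∑ c ∈ monicLT F (N + 1), (φ c / ψ c) ^ l = (S + lam) ^ l := by
      intro l hl hlq
      have h1 : ∀ c ∈ monicLT F (N + 1), (φ c / ψ c) ^ l =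
          ∑ k ∈ Finset.range (l + 1), (φ c / ψ c - lam) ^ k * lam ^ (l - k) * (l.choose k : K) := by
        intro c _
        rw [← add_pow, sub_add_cancel]
      rw [Finset.sum_congr rfl h1, Finset.sum_comm, add_pow]
      refine Finset.sum_congr rfl fun k hk => ?_
      rw [← Finset.sum_mul, ← Finset.sum_mul]
      congr 2
      rcases Nat.eq_zero_or_pos k with rfl | hk0
      · simpa using hcard
      · exact hshift k hk0 (by have := Finset.mem_range.1 hk; omega)
    have h1 := hexp 1 le_rfl Fintype.card_pos
    simp only [pow_one] at h1
    rw [hexp l hl hlq, h1]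

/-- Division with remainder by a monic polynomial `p` of degree `d`. -/
theorem sum_degLT_add_mul {M : Type*} [AddCommMonoid M] {p : F[X]} (hp : p.Monic) (N : ℕ)
    (g : F[X] → M) :
    ∑ b ∈ degLT F p.natDegree, ∑ a ∈ degLT F N, g (b + p * a) =
      ∑ a ∈ degLT F (N + p.natDegree), g a := by
  rw [← Finset.sum_product']
  have hb : ∀ b ∈ degLT F p.natDegree, b.degree < p.degree := by
    intro b hb
    rw [degree_eq_natDegree hp.ne_zero]
    exact mem_degLT.1 hb
  refine Finset.sum_bij' (fun x _ => x.1 + p * x.2) (fun a _ => (a %ₘ p, a /ₘ p)) ?_ ?_ ?_ ?_ ?_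
  · rintro ⟨b, a⟩ h
    obtain ⟨h1, h2⟩ := Finset.mem_product.1 h
    refine add_mem_degLT (degLT_mono (by omega) h1) ?_
    by_cases ha : a = 0
    · simp [ha, zero_mem_degLT]
    · refine mem_degLT_of_natDegree_lt ?_
      rw [natDegree_mul hp.ne_zero ha]
      have := natDegree_lt_of_mem_degLT h2 ha
      simp only at this
      omega
  · intro a ha
    refine Finset.mem_product.2 ⟨mem_degLT.2 ?_, mem_degLT.2 ?_⟩
    · rw [← degree_eq_natDegree hp.ne_zero]
      exact degree_modByMonic_lt a hp
    · by_cases h0 : a /ₘ p = 0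
      · rw [h0, degree_zero]
        exact WithBot.bot_lt_coe _
      · rw [← natDegree_lt_iff_degree_lt h0, natDegree_divByMonic a hp]
        have ha0 : a ≠ 0 := fun h => h0 (by rw [h, zero_divByMonic])
        have h1 := natDegree_lt_of_mem_degLT ha ha0
        have h2 : ¬ a.degree < p.degree := fun h => h0 ((divByMonic_eq_zero_iff hp).2 h)
        have h3 := natDegree_le_natDegree (not_lt.1 h2)
        by_contra h4
        have : N = 0 := by omega
        subst this
        omega
  · rintro ⟨b, a⟩ h
    obtain ⟨h1, h2⟩ := Finset.mem_product.1 h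
    obtain ⟨h3, h4⟩ := div_modByMonic_unique a b hp ⟨rfl, hb b h1⟩
    exact Prod.ext h4 h3
  · intro a _
    exact modByMonic_add_div a p
  · simp

end Monic

section Ultrametric

open Filter Topology

variable {L : Type*} [NormedField L] [IsUltrametricDist L] {α : Type*}

theorem norm_one_add_le_one {x : L} (hx : ‖x‖ ≤ 1) : ‖1 + x‖ ≤ 1 :=
  (IsUltrametricDist.norm_add_le_max 1 x).trans (by simp [hx])

theorem norm_sub_le_of_le {x y : L} {δ : ℝ} (hx : ‖x‖ ≤ δ) (hy : ‖y‖ ≤ δ) : ‖x - y‖ ≤ δ := by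
  rw [sub_eq_add_neg]
  exact (IsUltrametricDist.norm_add_le_max _ _).trans (max_le hx (by rwa [norm_neg]))

theorem norm_add_le_of_le {x y : L} {δ : ℝ} (hx : ‖x‖ ≤ δ) (hy : ‖y‖ ≤ δ) : ‖x + y‖ ≤ δ :=
  (IsUltrametricDist.norm_add_le_max _ _).trans (max_le hx hy)

theorem norm_prod_one_add_le_one (s : Finset α) {f : α → L} (hf : ∀ i ∈ s, ‖f i‖ ≤ 1) :
    ‖∏ i ∈ s, (1 + f i)‖ ≤ 1 := by
  rw [norm_prod]
  exact Finset.prod_le_one (fun _ _ => norm_nonneg _) fun i hi => norm_one_add_le_one (hf i hi)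

theorem norm_prod_one_add_sub_one_le (s : Finset α) {f : α → L} {δ : ℝ} (h0 : 0 ≤ δ) (h1 : δ ≤ 1)
    (hf : ∀ i ∈ s, ‖f i‖ ≤ δ) : ‖∏ i ∈ s, (1 + f i) - 1‖ ≤ δ := by
  classical
  induction s using Finset.induction_on with
  | empty => simpa using h0
  | insert a s ha ih =>
    have hfa := hf a (Finset.mem_insert_self a s)
    have hfs := fun i hi => hf i (Finset.mem_insert_of_mem hi)
    rw [Finset.prod_insert ha, show (1 + f a) * ∏ i ∈ s, (1 + f i) - 1 =
      (∏ i ∈ s, (1 + f i) - 1) + f a * ∏ i ∈ s, (1 + f i) by ring]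
    refine norm_add_le_of_le (ih hfs) ?_
    rw [norm_mul]
    exact (mul_le_of_le_one_right (norm_nonneg _)
      (norm_prod_one_add_le_one s fun i hi => (hfs i hi).trans h1)).trans hfa

theorem summable_of_norm_le [CompleteSpace L] {f : α → L} {b : α → ℝ}
    (hb : Tendsto b cofinite (𝓝 0)) (hf : ∀ i, ‖f i‖ ≤ b i) : Summable f :=
  NonarchimedeanAddGroup.summable_of_tendsto_cofinite_zero (squeeze_zero_norm hf hb)

theorem multipliable_one_add_of_tendsto [CompleteSpace L] {f : α → L}
    (hf : Tendsto f cofinite (𝓝 0)) : Multipliable fun i => 1 + f i := by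
  classical
  have hfin : ∀ δ : ℝ, 0 < δ → {i | ¬ ‖f i‖ < δ}.Finite := by
    intro δ hδ
    have := (tendsto_zero_iff_norm_tendsto_zero.1 hf).eventually (gt_mem_nhds hδ)
    exact eventually_cofinite.1 this
  have hC : CauchySeq fun s : Finset α => ∏ i ∈ s, (1 + f i) := by
    rw [Metric.cauchySeq_iff']
    intro ε hε
    set s₀ := (hfin 1 one_pos).toFinset
    set B := ‖∏ i ∈ s₀, (1 + f i)‖ with hB
    have hB0 : 0 ≤ B := norm_nonneg _
    set δ := min 1 (ε / (B + 1) / 2) with hδ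
    have hδ0 : 0 < δ := by positivity
    set s₁ := (hfin δ hδ0).toFinset
    have h01 : s₀ ⊆ s₁ := by
      intro i hi
      simp only [s₀, s₁, Set.Finite.mem_toFinset, Set.mem_ofPred_eq, not_lt] at hi ⊢
      exact (min_le_left _ _).trans hi
    have hB1 : ‖∏ i ∈ s₁, (1 + f i)‖ ≤ B := by
      rw [← Finset.prod_sdiff h01, norm_mul]
      refine mul_le_of_le_one_left hB0 (norm_prod_one_add_le_one _ fun i hi => ?_)
      have := (Finset.mem_sdiff.1 hi).2
      simp only [s₀, Set.Finite.mem_toFinset, Set.mem_ofPred_eq, not_not] at this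
      exact this.le
    refine ⟨s₁, fun s hs => ?_⟩
    have hd : ‖∏ i ∈ s \ s₁, (1 + f i) - 1‖ ≤ δ := by
      refine norm_prod_one_add_sub_one_le _ hδ0.le (min_le_left _ _) fun i hi => ?_
      have := (Finset.mem_sdiff.1 hi).2
      simp only [s₁, Set.Finite.mem_toFinset, Set.mem_ofPred_eq, not_not] at this
      exact this.le
    rw [dist_eq_norm, ← Finset.prod_sdiff hs, ← sub_one_mul, norm_mul]
    calc _ ≤ δ * B := mul_le_mul hd hB1 (norm_nonneg _) hδ0.le
      _ ≤ ε / (B + 1) / 2 * B := mul_le_mul_of_nonneg_right (min_le_right _ _) hB0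
      _ = ε * (B / (B + 1)) / 2 := by ring
      _ ≤ ε * 1 / 2 := by
        gcongr
        rw [div_le_one (by positivity)]
        linarith
      _ < ε := by linarith
  obtain ⟨a, ha⟩ := cauchySeq_tendsto_of_complete hC
  exact ⟨a, ha⟩

/-- Dominated convergence for sums in an ultrametric field. -/
theorem tendsto_tsum_of_norm_le [CompleteSpace L] {f : ℕ → α → L} {g : α → L} {b : α → ℝ}
    (hb : Tendsto b cofinite (𝓝 0)) (hf : ∀ n i, ‖f n i‖ ≤ b i)
    (hlim : ∀ i, Tendsto (fun n => f n i) atTop (𝓝 (g i))) :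
    Tendsto (fun n => ∑' i, f n i) atTop (𝓝 (∑' i, g i)) := by
  have hg : ∀ i, ‖g i‖ ≤ b i := fun i =>
    le_of_tendsto (hlim i).norm (Eventually.of_forall fun n => hf n i)
  rw [Metric.tendsto_atTop']
  intro ε hε
  have hε2 : 0 < ε / 2 := by positivity
  have hfin : {i | ¬ b i < ε / 2}.Finite := eventually_cofinite.1 (hb.eventually (gt_mem_nhds hε2))
  have hev : ∀ᶠ n in atTop, ∀ i ∈ {i | ¬ b i < ε / 2}, ‖f n i - g i‖ < ε / 2 := by
    rw [eventually_all_finite hfin]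
    intro i _
    have := (tendsto_sub_nhds_zero_iff.2 (hlim i)).norm
    rw [norm_zero] at this
    exact this.eventually (gt_mem_nhds hε2)
  obtain ⟨n₀, hn₀⟩ := eventually_atTop.1 hev
  refine ⟨n₀, fun n hn => ?_⟩
  rw [dist_eq_norm, ← (summable_of_norm_le hb (hf n)).tsum_sub (summable_of_norm_le hb hg)]
  refine (IsUltrametricDist.norm_tsum_le_of_forall_le_of_nonneg hε2.le fun i => ?_).trans_lt
    (half_lt_self hε)
  by_cases hi : b i < ε / 2
  · exact norm_sub_le_of_le ((hf n i).trans hi.le) ((hg i).trans hi.le)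
  · exact (hn₀ n hn.le i hi).le

end Ultrametric

section LatticeFunctions

open Filter Topology

variable {F : Type*} [Field F] [Fintype F]

local notation "q" => Fintype.card F

theorem tendsto_natDegree_monic :
    Tendsto (fun c : {c : F[X] // c.Monic} => (c : F[X]).natDegree) cofinite atTop := by
  rw [tendsto_atTop]
  intro d
  refine eventually_cofinite.2 ?_
  have : {c : {c : F[X] // c.Monic} | ¬ d ≤ (c : F[X]).natDegree} ⊆
      Subtype.val ⁻¹' {a : F[X] | a.degree < d} := by
    intro c hc
    simp only [Set.mem_ofPred_eq, not_le] at hc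
    exact (natDegree_lt_iff_degree_lt c.2.ne_zero).1 hc
  exact ((finite_degree_lt F d).preimage Subtype.val_injective.injOn).subset this

theorem tendsto_natDegree_ne_zero :
    Tendsto (fun c : {c : F[X] // c ≠ 0} => (c : F[X]).natDegree) cofinite atTop := by
  rw [tendsto_atTop]
  intro d
  refine eventually_cofinite.2 ?_
  have : {c : {c : F[X] // c ≠ 0} | ¬ d ≤ (c : F[X]).natDegree} ⊆
      Subtype.val ⁻¹' {a : F[X] | a.degree < d} := by
    intro c hc
    simp only [Set.mem_ofPred_eq, not_le] at hc
    exact (natDegree_lt_iff_degree_lt c.2).1 hc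
  exact ((finite_degree_lt F d).preimage Subtype.val_injective.injOn).subset this

variable {L : Type*} [NormedField L] (ι : F[X] →+* L)

/-- The embedding `ι` of `A` respects the absolute values. -/
def IsNormEmbedding : Prop := ∀ a : F[X], a ≠ 0 → ‖ι a‖ = (q : ℝ) ^ a.natDegree

/-- The lattice function `x ∏ (1 - x / a)` over the nonzero `a ∈ A`. -/
def latticeFun (x : L) : L := x * ∏' a : {a : F[X] // a ≠ 0}, (1 - x / ι (a : F[X]))

variable {ι}

theorem IsNormEmbedding.injective (hι : IsNormEmbedding ι) : Function.Injective ι := by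
  rw [injective_iff_map_eq_zero]
  intro a h0
  by_contra ha
  have h := hι a ha
  rw [h0, norm_zero] at h
  have := pow_pos (zero_lt_one.trans (one_lt_q F)) a.natDegree
  linarith

theorem IsNormEmbedding.ne_zero (hι : IsNormEmbedding ι) {a : F[X]} (ha : a ≠ 0) : ι a ≠ 0 :=
  (map_ne_zero_iff ι hι.injective).2 ha

theorem IsNormEmbedding.one_le_norm (hι : IsNormEmbedding ι) {a : F[X]} (ha : a ≠ 0) :
    1 ≤ ‖ι a‖ := by
  rw [hι a ha]
  exact one_le_pow₀ (one_lt_q F).le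

theorem tendsto_div_cofinite (hι : IsNormEmbedding ι) (x : L) :
    Tendsto (fun a : {a : F[X] // a ≠ 0} => -(x / ι (a : F[X]))) cofinite (𝓝 0) := by
  rw [tendsto_zero_iff_norm_tendsto_zero]
  have h : ∀ a : {a : F[X] // a ≠ 0}, ‖-(x / ι (a : F[X]))‖ =
      ‖x‖ * ((q : ℝ) ^ (a : F[X]).natDegree)⁻¹ := by
    intro a
    rw [norm_neg, norm_div, hι a a.2, div_eq_mul_inv]
  simp_rw [h]
  have h2 : Tendsto (fun n : ℕ => ‖x‖ * ((q : ℝ) ^ n)⁻¹) atTop (𝓝 (‖x‖ * 0)) :=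
    (tendsto_inv_atTop_zero.comp (tendsto_pow_atTop_atTop_of_one_lt (one_lt_q F))).const_mul _
  rw [mul_zero] at h2
  exact h2.comp tendsto_natDegree_ne_zero

theorem tendsto_latExp [CompleteSpace L] [IsUltrametricDist L] (hι : IsNormEmbedding ι) (x : L) :
    Tendsto (fun N => latExp ι N x) atTop (𝓝 (latticeFun ι x)) := by
  classical
  have h := (multipliable_one_add_of_tendsto (tendsto_div_cofinite hι x)).hasProd
  simp_rw [← sub_eq_add_neg] at h
  have hs : Tendsto (fun N => (degLT F N).subtype fun a => a ≠ 0) atTop atTop := by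
    refine tendsto_atTop_finset_of_monotone ?_ ?_
    · intro M N hMN a ha
      rw [Finset.mem_subtype] at ha ⊢
      exact degLT_mono hMN ha
    · intro a
      exact ⟨(a : F[X]).natDegree + 1,
        Finset.mem_subtype.2 (mem_degLT_of_natDegree_lt (Nat.lt_succ_self _))⟩
  have h2 := (Tendsto.comp h hs).const_mul x
  refine h2.congr fun N => ?_
  rw [latExp_eq hι.injective, Function.comp_apply]
  congr 1
  rw [← Finset.filter_ne', Finset.prod_subtype_eq_prod_filter (fun a => 1 - x / ι a)]

theorem latticeFun_add [CompleteSpace L] [IsUltrametricDist L] (hι : IsNormEmbedding ι) (x y : L) :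
    latticeFun ι (x + y) = latticeFun ι x + latticeFun ι y := by
  refine tendsto_nhds_unique (tendsto_latExp hι (x + y)) ?_
  simp_rw [latExp_add]
  exact (tendsto_latExp hι x).add (tendsto_latExp hι y)

theorem latticeFun_map_mul [CompleteSpace L] [IsUltrametricDist L] (hι : IsNormEmbedding ι) (ε : F)
    (x : L) : latticeFun ι (ι (C ε) * x) = ι (C ε) * latticeFun ι x := by
  refine tendsto_nhds_unique (tendsto_latExp hι _) ?_
  simp_rw [latExp_map_mul]
  exact (tendsto_latExp hι x).const_mul _

theorem latticeFun_map [CompleteSpace L] [IsUltrametricDist L] (hι : IsNormEmbedding ι) (a : F[X]) :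
    latticeFun ι (ι a) = 0 := by
  refine tendsto_nhds_unique (tendsto_latExp hι _) (tendsto_const_nhds.congr' ?_)
  filter_upwards [eventually_gt_atTop a.natDegree] with N hN
  rw [latExp_map_eq_zero ι (mem_degLT_of_natDegree_lt hN)]

theorem latticeFun_add_map [CompleteSpace L] [IsUltrametricDist L] (hι : IsNormEmbedding ι) (x : L)
    (a : F[X]) : latticeFun ι (x + ι a) = latticeFun ι x := by
  rw [latticeFun_add hι, latticeFun_map hι, add_zero]

theorem norm_latExp_sub_le [IsUltrametricDist L] (hι : IsNormEmbedding ι) {x : L} {N M : ℕ}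
    (hNM : N ≤ M) (hx : ‖x‖ ≤ (q : ℝ) ^ N) :
    ‖latExp ι M x - latExp ι N x‖ ≤ ‖latExp ι N x‖ * (‖x‖ / (q : ℝ) ^ N) := by
  classical
  have hq := one_lt_q F
  have hsub : (degLT F N).erase 0 ⊆ (degLT F M).erase 0 := Finset.erase_subset_erase _
    (degLT_mono hNM)
  have h1 : latExp ι M x = latExp ι N x *
      ∏ a ∈ (degLT F M).erase 0 \ (degLT F N).erase 0, (1 + -(x / ι a)) := by
    rw [latExp_eq hι.injective, latExp_eq hι.injective, ← Finset.prod_sdiff hsub]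
    simp_rw [← sub_eq_add_neg]
    ring
  rw [h1, ← mul_sub_one, norm_mul]
  refine mul_le_mul_of_nonneg_left ?_ (norm_nonneg _)
  refine norm_prod_one_add_sub_one_le _ (by positivity) ((div_le_one (by positivity)).2 hx) ?_
  intro a ha
  obtain ⟨ha1, ha2⟩ := Finset.mem_sdiff.1 ha
  have ha0 := (Finset.mem_erase.1 ha1).1
  have hd : N ≤ a.natDegree := by
    by_contra h
    exact ha2 (Finset.mem_erase.2 ⟨ha0, mem_degLT_of_natDegree_lt (not_le.1 h)⟩)
  rw [norm_neg, norm_div, hι a ha0]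
  gcongr
  exact hq.le

theorem norm_latticeFun_sub_le [CompleteSpace L] [IsUltrametricDist L] (hι : IsNormEmbedding ι)
    {x : L} {N : ℕ} (hx : ‖x‖ ≤ (q : ℝ) ^ N) :
    ‖latticeFun ι x - latExp ι N x‖ ≤ ‖latExp ι N x‖ * (‖x‖ / (q : ℝ) ^ N) := by
  refine le_of_tendsto ((tendsto_latExp hι x).sub_const _).norm ?_
  filter_upwards [eventually_ge_atTop N] with M hM using norm_latExp_sub_le hι hM hx

/-- Lower bound for the lattice polynomials away from the lattice. -/
theorem le_norm_latExp [IsUltrametricDist L] (hι : IsNormEmbedding ι) {x : L} {N m : ℕ} {r : ℝ}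
    (hx : ∀ a ∈ degLT F N, r ≤ ‖x + ι a‖) (hm : m ≤ N)
    (hmr : 1 ≤ m → (q : ℝ) ^ m ≤ r) : r * (q : ℝ) ^ (q ^ m - 1) ≤ ‖latExp ι N x‖ := by
  classical
  have hq := one_lt_q F
  obtain ⟨a₀, ha₀, hmin⟩ := Finset.exists_min_image (degLT F N) (fun a => ‖x + ι a‖)
    ⟨0, zero_mem_degLT N⟩
  set y := x + ι a₀ with hy
  have hxy : latExp ι N x = latExp ι N y := by
    rw [hy, latExp_add, latExp_map_eq_zero ι ha₀, add_zero]
  have hry : r ≤ ‖y‖ := hx a₀ ha₀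
  have hya : ∀ a ∈ degLT F N, ‖y‖ ≤ ‖y - ι a‖ := by
    intro a ha
    have := hmin (a₀ + -a) (add_mem_degLT ha₀ (neg_mem_degLT ha))
    rwa [map_add, map_neg, ← add_assoc, ← sub_eq_add_neg, ← hy] at this
  have hfac1 : ∀ a ∈ (degLT F N).erase 0, 1 ≤ ‖1 - y / ι a‖ := by
    intro a ha
    obtain ⟨ha0, haN⟩ := Finset.mem_erase.1 ha
    have h0 := hι.ne_zero ha0
    rw [show 1 - y / ι a = -((y - ι a) / ι a) by field_simp; ring, norm_neg, norm_div,
      one_le_div (norm_pos_iff.2 h0)]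
    have : ι a = y - (y - ι a) := by ring
    rw [this]
    simp only [sub_sub_cancel]
    conv_lhs => rw [this]
    exact norm_sub_le_of_le (hya a haN) le_rfl
  have hfac2 : ∀ a ∈ (degLT F N).erase 0, ‖y‖ / ‖ι a‖ ≤ ‖1 - y / ι a‖ := by
    intro a ha
    obtain ⟨ha0, haN⟩ := Finset.mem_erase.1 ha
    have h0 := hι.ne_zero ha0
    rw [show 1 - y / ι a = -((y - ι a) / ι a) by field_simp; ring, norm_neg, norm_div]
    gcongr
    exact hya a haN
  have hsub : (degLT F m).erase 0 ⊆ (degLT F N).erase 0 :=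
    Finset.erase_subset_erase _ (degLT_mono hm)
  have hprod : (q : ℝ) ^ (q ^ m - 1) ≤ ∏ a ∈ (degLT F N).erase 0, ‖1 - y / ι a‖ := by
    rw [← Finset.prod_sdiff hsub]
    have h1 : 1 ≤ ∏ a ∈ (degLT F N).erase 0 \ (degLT F m).erase 0, ‖1 - y / ι a‖ :=
      Finset.one_le_prod fun a ha => hfac1 a (Finset.mem_sdiff.1 ha).1
    refine le_trans ?_ (le_mul_of_one_le_left (Finset.prod_nonneg fun _ _ => norm_nonneg _) h1)
    have hcard : ((degLT F m).erase 0).card = q ^ m - 1 := by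
      rw [Finset.card_erase_of_mem (zero_mem_degLT m), card_degLT]
    rw [← hcard, ← Finset.prod_const]
    refine Finset.prod_le_prod (fun _ _ => by positivity) fun a ha => ?_
    refine le_trans ?_ (hfac2 a (hsub ha))
    obtain ⟨ha0, ham⟩ := Finset.mem_erase.1 ha
    have hd := natDegree_lt_of_mem_degLT ham ha0
    rw [hι a ha0, le_div_iff₀ (by positivity), ← pow_succ']
    exact (pow_le_pow_right₀ hq.le hd).trans ((hmr (by omega)).trans hry)
  rw [hxy, latExp_eq hι.injective, norm_mul, norm_prod]
  exact mul_le_mul hry hprod (by positivity) (norm_nonneg _)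

end LatticeFunctions

section AExpansion

open Filter Topology

variable {F : Type*} [Field F] [Fintype F]

local notation "q" => Fintype.card F

variable (F) in
/-- The bound for the terms of degree `d` of an `A`-expansion at points of imaginary distance at
least `r`, where `1 ≤ r q ^ s`. -/
def decayBound (r : ℝ) (s Q d : ℕ) : ℝ :=
  (q : ℝ) ^ (d * Q) / (r * (q : ℝ) ^ (q ^ (d - s) - 1))

theorem tendsto_decayBound {r : ℝ} (hr : 0 < r) (s Q : ℕ) :
    Tendsto (decayBound F r s Q) atTop (𝓝 0) := by
  have hq := one_lt_q F
  have hq' : 1 < q := Fintype.one_lt_card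
  have hq0 : (0 : ℝ) < q := zero_lt_one.trans hq
  rw [← tendsto_add_atTop_iff_nat s]
  have hev : ∀ᶠ k : ℕ in atTop, k * (Q + 1) ≤ q ^ k - 1 := by
    have h1 : Tendsto (fun k : ℕ => (k : ℝ) ^ 2 / (q : ℝ) ^ k) atTop (𝓝 0) :=
      tendsto_pow_const_div_const_pow_of_one_lt 2 hq
    filter_upwards [h1.eventually (gt_mem_nhds one_pos), eventually_ge_atTop (Q + 1)] with k hk hkQ
    rw [div_lt_one (by positivity)] at hk
    have hk' : k ^ 2 < q ^ k := by exact_mod_cast hk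
    have : k * (Q + 1) ≤ k ^ 2 := by
      rw [sq]
      exact Nat.mul_le_mul_left _ hkQ
    omega
  have hlim : Tendsto (fun k : ℕ => (q : ℝ) ^ (s * Q) / r * ((q : ℝ) ^ k)⁻¹) atTop (𝓝 0) := by
    have := (tendsto_inv_atTop_zero.comp (tendsto_pow_atTop_atTop_of_one_lt hq)).const_mul
      ((q : ℝ) ^ (s * Q) / r)
    rwa [mul_zero] at this
  refine squeeze_zero' (Eventually.of_forall fun k => ?_) ?_ hlim
  · unfold decayBound
    positivity
  · filter_upwards [hev] with k hk
    unfold decayBound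
    rw [Nat.add_sub_cancel, div_mul_eq_mul_div, ← div_eq_mul_inv, div_div,
      div_le_div_iff₀ (by positivity) (by positivity)]
    have : (q : ℝ) ^ ((k + s) * Q) * (q : ℝ) ^ k ≤ (q : ℝ) ^ (s * Q) * (q : ℝ) ^ (q ^ k - 1) := by
      rw [← pow_add, ← pow_add]
      refine pow_le_pow_right₀ hq.le ?_
      nlinarith
    nlinarith

variable {L : Type*} [NormedField L] (ι : F[X] →+* L)

/-- `z` has distance at least `r` from `K`. -/
def FarFromK (r : ℝ) (z : L) : Prop := ∀ c a : F[X], r * ‖ι c‖ ≤ ‖ι c * z + ι a‖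

variable {ι}

theorem le_norm_latExp_mul [IsUltrametricDist L] (hι : IsNormEmbedding ι) {r : ℝ} {s : ℕ}
    (hr : 0 < r) (hs : 1 ≤ r * (q : ℝ) ^ s) {z : L} (hz : FarFromK ι r z) {c : F[X]} (hc : c ≠ 0)
    {N : ℕ} (hN : c.natDegree ≤ N) :
    r * (q : ℝ) ^ (q ^ (c.natDegree - s) - 1) ≤ ‖latExp ι N (ι c * z)‖ := by
  have hq := one_lt_q F
  have h := le_norm_latExp hι (x := ι c * z) (N := N) (m := c.natDegree - s) (r := r * ‖ι c‖)
    (fun a _ => hz c a) (by omega) ?_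
  · refine le_trans ?_ h
    gcongr
    exact le_mul_of_one_le_right hr.le (hι.one_le_norm hc)
  · intro hm
    rw [hι c hc]
    obtain ⟨m, hm'⟩ : ∃ m, c.natDegree = m + s := ⟨c.natDegree - s, by omega⟩
    rw [hm', Nat.add_sub_cancel, pow_add, mul_left_comm]
    exact le_mul_of_one_le_right (by positivity) hs

variable (ι) in
/-- The approximation `c ^ Q / e_N(c z)` of `aQuot`. -/
def aQuotFin (Q N : ℕ) (z : L) (c : F[X]) : L := ι c ^ Q / latExp ι N (ι c * z)

theorem norm_aQuotFin_le [IsUltrametricDist L] (hι : IsNormEmbedding ι) {r : ℝ} {s : ℕ}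
    (hr : 0 < r) (hs : 1 ≤ r * (q : ℝ) ^ s) {z : L} (hz : FarFromK ι r z) (Q : ℕ) {c : F[X]}
    (hc : c ≠ 0) {N : ℕ} (hN : c.natDegree ≤ N) :
    ‖aQuotFin ι Q N z c‖ ≤ decayBound F r s Q c.natDegree := by
  have hq0 : (0 : ℝ) < q := zero_lt_one.trans (one_lt_q F)
  rw [aQuotFin, norm_div, norm_pow, hι c hc, ← pow_mul, decayBound]
  exact div_le_div_of_nonneg_left (by positivity) (by positivity)
    (le_norm_latExp_mul hι hr hs hz hc hN)

theorem sum_sum_eq_neg_sum_aQuotFin (hι : IsNormEmbedding ι) {r : ℝ} (hr : 0 < r) {z : L}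
    (hz : FarFromK ι r z) (ν N : ℕ) :
    ∑ c ∈ degLT F N, ∑ a ∈ degLT F N, ι c ^ q ^ ν * (ι c * z + ι a)⁻¹ =
      -∑ c ∈ monicLT F N, aQuotFin ι (q ^ ν) N z c := by
  classical
  have hQ : q ^ ν ≠ 0 := by positivity
  rw [← sum_erase_zero_eq_neg_sum_monicLT (ι.comp C), ← Finset.add_sum_erase _ _ (zero_mem_degLT N)]
  · simp only [map_zero, zero_pow hQ, zero_mul, Finset.sum_const_zero, zero_add]
    refine Finset.sum_congr rfl fun c hc => ?_
    have hc0 := (Finset.mem_erase.1 hc).1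
    have h := sum_inv_pow_degLT hι.injective (N := N) (x := ι c * z) (k := 1) ?_ le_rfl
      Fintype.card_pos
    · simp only [pow_one] at h
      rw [← Finset.mul_sum, h, aQuotFin, div_eq_mul_inv]
    · intro a _
      refine norm_pos_iff.1 (lt_of_lt_of_le ?_ (hz c a))
      exact mul_pos hr (norm_pos_iff.2 (hι.ne_zero hc0))
  · intro ε c hε
    have h1 := map_pow_card_pow (ι.comp C) ν ε
    rw [RingHom.comp_apply] at h1
    have h0 : ι (C ε) ≠ 0 := hι.ne_zero (C_ne_zero.2 hε)
    rw [aQuotFin, aQuotFin, map_mul, mul_pow, h1, mul_assoc, latExp_map_mul,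
      mul_div_mul_left _ _ h0]

theorem tendsto_monicLT_subtype [DecidablePred fun c : F[X] => c.Monic] :
    Tendsto (fun N => (monicLT F N).subtype fun c => c.Monic) atTop atTop := by
  refine tendsto_atTop_finset_of_monotone ?_ ?_
  · intro M N hMN a ha
    rw [Finset.mem_subtype, mem_monicLT_iff] at ha ⊢
    exact ⟨ha.1.trans_le hMN, ha.2⟩
  · intro a
    exact ⟨(a : F[X]).natDegree + 1,
      Finset.mem_subtype.2 (mem_monicLT_iff.2 ⟨Nat.lt_succ_self _, a.2⟩)⟩

theorem tendsto_sum_monicLT {g : F[X] → L} {S : L}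
    (h : HasSum (fun c : {c : F[X] // c.Monic} => g c) S) :
    Tendsto (fun N => ∑ c ∈ monicLT F N, g c) atTop (𝓝 S) := by
  classical
  refine (Tendsto.comp h tendsto_monicLT_subtype).congr fun N => ?_
  rw [Function.comp_apply, Finset.sum_subtype_of_mem]
  exact fun c hc => (mem_monicLT.1 hc).2

variable [CompleteSpace L] [IsUltrametricDist L]

theorem le_norm_latticeFun_mul (hι : IsNormEmbedding ι) {r : ℝ} {s : ℕ}
    (hr : 0 < r) (hs : 1 ≤ r * (q : ℝ) ^ s) {z : L} (hz : FarFromK ι r z) {c : F[X]} (hc : c ≠ 0) :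
    r * (q : ℝ) ^ (q ^ (c.natDegree - s) - 1) ≤ ‖latticeFun ι (ι c * z)‖ := by
  refine ge_of_tendsto (tendsto_latExp hι _).norm ?_
  filter_upwards [eventually_ge_atTop c.natDegree] with N hN
  exact le_norm_latExp_mul hι hr hs hz hc hN

theorem exists_one_le_mul_pow {r : ℝ} (hr : 0 < r) : ∃ s : ℕ, 1 ≤ r * (q : ℝ) ^ s := by
  obtain ⟨s, hs⟩ := pow_unbounded_of_one_lt r⁻¹ (one_lt_q F)
  refine ⟨s, ?_⟩
  have := mul_le_mul_of_nonneg_left hs.le hr.le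
  rwa [mul_inv_cancel₀ hr.ne'] at this

theorem le_norm_latticeFun_mul' (hι : IsNormEmbedding ι) {r : ℝ}
    (hr : 0 < r) {z : L} (hz : FarFromK ι r z) {c : F[X]} (hc : c ≠ 0) :
    r ≤ ‖latticeFun ι (ι c * z)‖ := by
  obtain ⟨s, hs⟩ := exists_one_le_mul_pow (F := F) hr
  refine le_trans ?_ (le_norm_latticeFun_mul hι hr hs hz hc)
  exact le_mul_of_one_le_right hr.le (one_le_pow₀ (one_lt_q F).le)

theorem latticeFun_mul_ne_zero (hι : IsNormEmbedding ι) {r : ℝ}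
    (hr : 0 < r) {z : L} (hz : FarFromK ι r z) {c : F[X]} (hc : c ≠ 0) :
    latticeFun ι (ι c * z) ≠ 0 :=
  norm_pos_iff.1 (hr.trans_le (le_norm_latticeFun_mul' hι hr hz hc))

variable (ι) in
/-- The term `c ^ Q / e_A(c z)`. -/
def aQuot (Q : ℕ) (z : L) (c : F[X]) : L := ι c ^ Q / latticeFun ι (ι c * z)

theorem norm_aQuot_le (hι : IsNormEmbedding ι) {r : ℝ} {s : ℕ}
    (hr : 0 < r) (hs : 1 ≤ r * (q : ℝ) ^ s) {z : L} (hz : FarFromK ι r z) (Q : ℕ) {c : F[X]}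
    (hc : c ≠ 0) : ‖aQuot ι Q z c‖ ≤ decayBound F r s Q c.natDegree := by
  have hq0 : (0 : ℝ) < q := zero_lt_one.trans (one_lt_q F)
  rw [aQuot, norm_div, norm_pow, hι c hc, ← pow_mul, decayBound]
  exact div_le_div_of_nonneg_left (by positivity) (by positivity)
    (le_norm_latticeFun_mul hι hr hs hz hc)

theorem tendsto_decayBound_cofinite {r : ℝ} (hr : 0 < r) (s Q : ℕ) :
    Tendsto (fun c : {c : F[X] // c.Monic} => decayBound F r s Q (c : F[X]).natDegree)
      cofinite (𝓝 0) :=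
  (tendsto_decayBound hr s Q).comp tendsto_natDegree_monic

theorem tendsto_aQuot_cofinite (hι : IsNormEmbedding ι) {r : ℝ} (hr : 0 < r) {z : L}
    (hz : FarFromK ι r z) (Q : ℕ) :
    Tendsto (fun c : {c : F[X] // c.Monic} => aQuot ι Q z c) cofinite (𝓝 0) := by
  obtain ⟨s, hs⟩ := exists_one_le_mul_pow (F := F) hr
  exact squeeze_zero_norm (fun c => norm_aQuot_le hι hr hs hz Q c.2.ne_zero)
    (tendsto_decayBound_cofinite hr s Q)

theorem summable_aQuot_pow (hι : IsNormEmbedding ι) {r : ℝ} (hr : 0 < r) {z : L}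
    (hz : FarFromK ι r z) (Q : ℕ) {l : ℕ} (hl : 1 ≤ l) :
    Summable fun c : {c : F[X] // c.Monic} => aQuot ι Q z c ^ l := by
  refine NonarchimedeanAddGroup.summable_of_tendsto_cofinite_zero ?_
  have := (tendsto_aQuot_cofinite hι hr hz Q).pow l
  rwa [zero_pow (by omega)] at this

variable (ι) in
/-- The sum of the terms `c ^ Q / e_A(c z)` over the monic `c ∈ A`. -/
def aSum (Q : ℕ) (z : L) : L := ∑' c : {c : F[X] // c.Monic}, aQuot ι Q z c

theorem aSum_pow (hι : IsNormEmbedding ι) {r : ℝ} (hr : 0 < r) {z : L}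
    (hz : FarFromK ι r z) (ν : ℕ) {l : ℕ} (hl : 1 ≤ l) (hlq : l ≤ q) :
    ∑' c : {c : F[X] // c.Monic}, aQuot ι (q ^ ν) z c ^ l = aSum ι (q ^ ν) z ^ l := by
  have h1 := tendsto_sum_monicLT (g := fun c => aQuot ι (q ^ ν) z c ^ l)
    (summable_aQuot_pow hι hr hz (q ^ ν) hl).hasSum
  have h2 := tendsto_sum_monicLT (g := fun c => aQuot ι (q ^ ν) z c)
    (by simpa using (summable_aQuot_pow hι hr hz (q ^ ν) le_rfl).hasSum)
  refine tendsto_nhds_unique h1 ((h2.pow l).congr fun N => ?_)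
  let φ : F[X] →+ L :=
    { toFun := fun c => ι c ^ q ^ ν
      map_zero' := by simp [Fintype.card_ne_zero]
      map_add' := fun a b => by rw [map_add, add_pow_card_pow (ι.comp C)] }
  let ψ : F[X] →+ L :=
    { toFun := fun c => latticeFun ι (ι c * z)
      map_zero' := by rw [map_zero, zero_mul, latticeFun, zero_mul]
      map_add' := fun a b => by rw [map_add, add_mul, latticeFun_add hι] }
  symm
  refine sum_monicLT_div_pow (ι.comp C) N (φ := φ) (ψ := ψ) ?_ ?_ ?_ hl hlq
  · intro ε a
    have := map_pow_card_pow (ι.comp C) ν ε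
    simp only [φ, AddMonoidHom.coe_mk, ZeroHom.coe_mk, map_mul, mul_pow]
    rw [← this]
    rfl
  · intro ε a
    simp only [ψ, AddMonoidHom.coe_mk, ZeroHom.coe_mk, map_mul, mul_assoc]
    rw [latticeFun_map_mul hι]
    rfl
  · rw [injective_iff_map_eq_zero]
    intro c h0
    by_contra hc
    exact latticeFun_mul_ne_zero hι hr hz hc h0

theorem tendsto_aQuotFin (hι : IsNormEmbedding ι) {r : ℝ} (hr : 0 < r) {z : L}
    (hz : FarFromK ι r z) (Q : ℕ) {c : F[X]} (hc : c ≠ 0) :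
    Tendsto (fun N => aQuotFin ι Q N z c) atTop (𝓝 (aQuot ι Q z c)) :=
  tendsto_const_nhds.div (tendsto_latExp hι _) (latticeFun_mul_ne_zero hι hr hz hc)

theorem tendsto_sum_aQuotFin (hι : IsNormEmbedding ι) {r : ℝ} (hr : 0 < r) {z : L}
    (hz : FarFromK ι r z) (Q : ℕ) :
    Tendsto (fun N => ∑ c ∈ monicLT F N, aQuotFin ι Q N z c) atTop (𝓝 (aSum ι Q z)) := by
  classical
  obtain ⟨s, hs⟩ := exists_one_le_mul_pow (F := F) hr
  have hbd : ∀ d, 0 ≤ decayBound F r s Q d := fun d => by unfold decayBound; positivity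
  have h := tendsto_tsum_of_norm_le
    (f := fun N (c : {c : F[X] // c.Monic}) =>
      if (c : F[X]) ∈ monicLT F N then aQuotFin ι Q N z c else 0)
    (g := fun c => aQuot ι Q z c) (tendsto_decayBound_cofinite hr s Q) ?_ ?_
  · refine h.congr fun N => ?_
    rw [tsum_eq_sum (s := (monicLT F N).subtype fun c => c.Monic)]
    · rw [Finset.sum_congr rfl fun c hc => if_pos (Finset.mem_subtype.1 hc)]
      exact Finset.sum_subtype_of_mem (fun c => aQuotFin ι Q N z c) fun c hc => (mem_monicLT.1 hc).2
    · intro c hc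
      rw [Finset.mem_subtype] at hc
      rw [if_neg hc]
  · intro N c
    split_ifs with h
    · exact norm_aQuotFin_le hι hr hs hz Q c.2.ne_zero (mem_monicLT_iff.1 h).1.le
    · rw [norm_zero]
      exact hbd _
  · intro c
    refine (tendsto_aQuotFin hι hr hz Q c.2.ne_zero).congr' ?_
    filter_upwards [eventually_gt_atTop (c : F[X]).natDegree] with N hN
    rw [if_pos (mem_monicLT_iff.2 ⟨hN, c.2⟩)]

theorem aSum_inversion (hι : IsNormEmbedding ι) {r r' : ℝ} (hr : 0 < r) (hr' : 0 < r') {z : L}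
    (hz0 : z ≠ 0) (hz : FarFromK ι r z) (hz' : FarFromK ι r' (-1 / z)) {ν : ℕ} (hν : 1 ≤ ν) :
    aSum ι (q ^ ν) (-1 / z) = z ^ (q ^ ν + 1) * aSum ι (q ^ ν) z := by
  have h1 := tendsto_sum_aQuotFin hι hr hz (q ^ ν)
  have h2 := tendsto_sum_aQuotFin hι hr' hz' (q ^ ν)
  refine tendsto_nhds_unique h2 ((h1.const_mul (z ^ (q ^ ν + 1))).congr' ?_)
  filter_upwards [eventually_ge_atTop (q ^ ν)] with N hN
  have h := sum_sum_inversion (ι := ι) hν hN hz0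
  rw [sum_sum_eq_neg_sum_aQuotFin hι hr hz, sum_sum_eq_neg_sum_aQuotFin hι hr' hz'] at h
  linear_combination h

theorem aQuot_add_map (hι : IsNormEmbedding ι) (Q : ℕ) (z : L) (b c : F[X]) :
    aQuot ι Q (z + ι b) c = aQuot ι Q z c := by
  rw [aQuot, mul_add, ← map_mul, latticeFun_add_map hι, aQuot]

theorem aSum_add_map (hι : IsNormEmbedding ι) (Q : ℕ) (z : L) (b : F[X]) :
    aSum ι Q (z + ι b) = aSum ι Q z := by
  simp only [aSum, aQuot_add_map hι]

theorem aSum_map_mul (hι : IsNormEmbedding ι) (Q : ℕ) (z : L) (ε : F) :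
    aSum ι Q (ι (C ε) * z) = (ι (C ε))⁻¹ * aSum ι Q z := by
  rw [aSum, aSum, ← tsum_mul_left]
  refine tsum_congr fun c => ?_
  rw [aQuot, aQuot, mul_left_comm, latticeFun_map_mul hι, div_eq_mul_inv, mul_inv, div_eq_mul_inv]
  ring

end AExpansion

section Hecke

open Filter Topology

variable {F : Type*} [Field F] {L : Type*} [NormedField L] {ι : F[X] →+* L}

variable [Fintype F]

local notation "q" => Fintype.card F

theorem FarFromK.add_div (hι : IsNormEmbedding ι) {r : ℝ} {z : L} (hz : FarFromK ι r z) (b : F[X])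
    {p : F[X]} (hp : p ≠ 0) : FarFromK ι (r / ‖ι p‖) ((z + ι b) / ι p) := by
  intro c a
  have h0 := hι.ne_zero hp
  have h := hz c (c * b + p * a)
  have e : ι c * ((z + ι b) / ι p) + ι a = (ι c * z + ι (c * b + p * a)) / ι p := by
    rw [map_add, map_mul, map_mul]
    field_simp
    ring
  rw [e, norm_div, div_mul_eq_mul_div]
  gcongr

variable [CompleteSpace L] [IsUltrametricDist L]

theorem latticeFun_ne_zero (hι : IsNormEmbedding ι) {r : ℝ} (hr : 0 < r) {x : L}
    (hx : ∀ a : F[X], r ≤ ‖x + ι a‖) : latticeFun ι x ≠ 0 := by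
  refine norm_pos_iff.1 (hr.trans_le (ge_of_tendsto (tendsto_latExp hι x).norm ?_))
  filter_upwards with N
  simpa using le_norm_latExp hι (m := 0) (fun a _ => hx a) (Nat.zero_le N) (by omega)

theorem sum_latticeFun_inv_pow (hι : IsNormEmbedding ι) {r : ℝ} (hr : 0 < r) {x : L}
    (hx : ∀ a : F[X], r ≤ ‖x + ι a‖) {p : F[X]} (hp : p.Monic) {k : ℕ} (hk : 1 ≤ k)
    (hkq : k ≤ q) :
    ∑ b ∈ degLT F p.natDegree, ((latticeFun ι ((x + ι b) / ι p))⁻¹) ^ k =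
      (ι p * (latticeFun ι x)⁻¹) ^ k := by
  have hp0 := hι.ne_zero hp.ne_zero
  have e : ∀ b a : F[X], (x + ι b) / ι p + ι a = (x + ι (b + p * a)) / ι p := by
    intro b a
    rw [map_add, map_mul]
    field_simp
    ring
  have hne : ∀ a, x + ι a ≠ 0 := fun a => norm_pos_iff.1 (hr.trans_le (hx a))
  have hfin : ∀ N, ∑ b ∈ degLT F p.natDegree, ((latExp ι N ((x + ι b) / ι p))⁻¹) ^ k =
      (ι p * (latExp ι (N + p.natDegree) x)⁻¹) ^ k := by
    intro N
    rw [mul_pow, ← sum_inv_pow_degLT hι.injective (fun a _ => hne a) hk hkq,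
      ← sum_degLT_add_mul hp N, Finset.mul_sum]
    refine Finset.sum_congr rfl fun b _ => ?_
    rw [← sum_inv_pow_degLT hι.injective _ hk hkq, Finset.mul_sum]
    · refine Finset.sum_congr rfl fun a _ => ?_
      rw [e, inv_div, div_eq_mul_inv, mul_pow]
    · intro a _
      rw [e]
      exact div_ne_zero (hne _) hp0
  have h1 : Tendsto (fun N => ∑ b ∈ degLT F p.natDegree, ((latExp ι N ((x + ι b) / ι p))⁻¹) ^ k)
      atTop (𝓝 (∑ b ∈ degLT F p.natDegree, ((latticeFun ι ((x + ι b) / ι p))⁻¹) ^ k)) := by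
    refine tendsto_finsetSum _ fun b _ => ((tendsto_latExp hι _).inv₀ ?_).pow k
    refine latticeFun_ne_zero hι (r := r / ‖ι p‖) (div_pos hr (norm_pos_iff.2 hp0)) fun a => ?_
    rw [e, norm_div]
    gcongr
    exact hx _
  have h2 : Tendsto (fun N => (ι p * (latExp ι (N + p.natDegree) x)⁻¹) ^ k) atTop
      (𝓝 ((ι p * (latticeFun ι x)⁻¹) ^ k)) := by
    refine ((Tendsto.inv₀ ?_ (latticeFun_ne_zero hι hr hx)).const_mul _).pow k
    exact (tendsto_latExp hι x).comp (tendsto_add_atTop_nat p.natDegree)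
  exact tendsto_nhds_unique (h1.congr hfin) h2

theorem sum_mul_modByMonic {p c : F[X]} (hp : p.Monic) (hpc : IsCoprime c p) {M : Type*}
    [AddCommMonoid M] (g : F[X] → M) :
    ∑ b ∈ degLT F p.natDegree, g ((c * b) %ₘ p) = ∑ b ∈ degLT F p.natDegree, g b := by
  have hmem : ∀ a : F[X], a %ₘ p ∈ degLT F p.natDegree := fun a => mem_degLT.2 (by
    rw [← degree_eq_natDegree hp.ne_zero]
    exact degree_modByMonic_lt a hp)
  have hinj : Set.InjOn (fun b => (c * b) %ₘ p) (degLT F p.natDegree : Set F[X]) := by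
    intro b hb b' hb' h
    have h1 : p ∣ c * b - c * b' := by
      rw [← modByMonic_eq_zero_iff_dvd hp, sub_modByMonic]
      exact sub_eq_zero.2 h
    rw [← mul_sub] at h1
    have h2 := hpc.symm.dvd_of_dvd_mul_left h1
    by_contra hne
    have h3 := degree_le_of_dvd h2 (sub_ne_zero.2 hne)
    have h4 := mem_degLT.1 (add_mem_degLT hb (neg_mem_degLT hb'))
    rw [← sub_eq_add_neg, ← degree_eq_natDegree hp.ne_zero] at h4
    exact absurd h4 (not_lt.2 h3)
  classical
  have himg : (degLT F p.natDegree).image (fun b => (c * b) %ₘ p) = degLT F p.natDegree := by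
    refine Finset.eq_of_subset_of_card_le (Finset.image_subset_iff.2 fun b _ => hmem _) ?_
    rw [Finset.card_image_of_injOn hinj]
  conv_rhs => rw [← himg]
  rw [Finset.sum_image hinj]

theorem sum_aQuot_pow (hι : IsNormEmbedding ι) {r : ℝ} (hr : 0 < r) {z : L}
    (hz : FarFromK ι r z) (Q : ℕ) {p : F[X]} (hp : p.Monic) (hirr : Irreducible p) {k : ℕ}
    (hk : 1 ≤ k) (hkq : k ≤ q) {c : F[X]} (hc : c ≠ 0) [Decidable (p ∣ c)] :
    ∑ b ∈ degLT F p.natDegree, aQuot ι Q ((z + ι b) / ι p) c ^ k =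
      if p ∣ c then 0 else ι p ^ k * aQuot ι Q z c ^ k := by
  have hp0 := hι.ne_zero hp.ne_zero
  split_ifs with h
  · obtain ⟨c', rfl⟩ := h
    have e : ∀ b ∈ degLT F p.natDegree, aQuot ι Q ((z + ι b) / ι p) (p * c') ^ k =
        (ι (p * c') ^ Q / latticeFun ι (ι c' * z)) ^ k := by
      intro b _
      rw [aQuot, show ι (p * c') * ((z + ι b) / ι p) = ι c' * z + ι (c' * b) by
        rw [map_mul, map_mul]; field_simp, latticeFun_add_map hι]
    rw [Finset.sum_congr rfl e, Finset.sum_const, card_degLT, nsmul_eq_mul, Nat.cast_pow,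
      card_cast_eq_zero (ι.comp C), zero_pow hirr.natDegree_pos.ne', zero_mul]
  · have hcop : IsCoprime c p := ((EuclideanDomain.dvd_or_coprime p c hirr).resolve_left h).symm
    have hx : ∀ a : F[X], r * ‖ι c‖ ≤ ‖ι c * z + ι a‖ := fun a => hz c a
    have hrc : 0 < r * ‖ι c‖ := mul_pos hr (norm_pos_iff.2 (hι.ne_zero hc))
    have e : ∀ b ∈ degLT F p.natDegree, aQuot ι Q ((z + ι b) / ι p) c ^ k =
        (ι c ^ Q) ^ k * ((latticeFun ι ((ι c * z + ι ((c * b) %ₘ p)) / ι p))⁻¹) ^ k := by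
      intro b _
      have e2 : ι c * ((z + ι b) / ι p) =
          (ι c * z + ι ((c * b) %ₘ p)) / ι p + ι ((c * b) /ₘ p) := by
        have := congrArg ι (modByMonic_add_div (c * b) p)
        rw [map_add, map_mul, map_mul] at this
        field_simp
        linear_combination -this
      rw [aQuot, e2, latticeFun_add_map hι, div_eq_mul_inv, mul_pow]
    rw [Finset.sum_congr rfl e, ← Finset.mul_sum, sum_mul_modByMonic hp hcop
      fun b => ((latticeFun ι ((ι c * z + ι b) / ι p))⁻¹) ^ k,
      sum_latticeFun_inv_pow hι hrc hx hp hk hkq, aQuot, div_eq_mul_inv]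
    ring

/-- The Hecke operator attached to `p` multiplies an `A`-expansion of exponent `k` by `p ^ k`. -/
theorem hecke_tsum_aQuot_pow (hι : IsNormEmbedding ι) {r : ℝ} (hr : 0 < r) {z : L}
    (hz : FarFromK ι r z) (Q : ℕ) {p : F[X]} (hp : p.Monic) (hirr : Irreducible p) {k : ℕ}
    (hk : 1 ≤ k) (hkq : k ≤ q) :
    ι p ^ (k * Q + k) * ∑' c : {c : F[X] // c.Monic}, aQuot ι Q (ι p * z) c ^ k +
      ∑ b ∈ degLT F p.natDegree, ∑' c : {c : F[X] // c.Monic}, aQuot ι Q ((z + ι b) / ι p) c ^ k =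
      ι p ^ k * ∑' c : {c : F[X] // c.Monic}, aQuot ι Q z c ^ k := by
  classical
  have hp0 := norm_pos_iff.2 (hι.ne_zero hp.ne_zero)
  have hsum := (summable_aQuot_pow hι hr hz Q hk).mul_left (ι p ^ k)
  let m : {c : F[X] // c.Monic} → {c : F[X] // c.Monic} := fun c => ⟨p * c, hp.mul c.2⟩
  have hm : Function.Injective m := by
    intro c c' h
    exact Subtype.ext (mul_left_cancel₀ hp.ne_zero (congrArg Subtype.val h))
  rw [← Summable.tsum_finsetSum fun b _ => summable_aQuot_pow hι (div_pos hr hp0)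
    (hz.add_div hι b hp.ne_zero) Q hk, ← tsum_mul_left, ← tsum_mul_left]
  simp_rw [fun c : {c : F[X] // c.Monic} => sum_aQuot_pow hι hr hz Q hp hirr hk hkq c.2.ne_zero]
  have e1 : ∀ c : {c : F[X] // c.Monic}, ι p ^ (k * Q + k) * aQuot ι Q (ι p * z) c ^ k =
      ι p ^ k * aQuot ι Q z (m c) ^ k := by
    intro c
    simp only [m, aQuot, map_mul]
    rw [show ι c * (ι p * z) = ι p * ι c * z by ring]
    ring
  simp_rw [e1]
  set G : {c : F[X] // c.Monic} → L := fun c => ι p ^ k * aQuot ι Q z c ^ k with hG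
  have hrange : ∀ c : {c : F[X] // c.Monic}, c ∈ Set.range m ↔ p ∣ (c : F[X]) := by
    intro c
    constructor
    · rintro ⟨c', rfl⟩
      exact dvd_mul_right _ _
    · rintro ⟨c', hc'⟩
      exact ⟨⟨c', hp.of_mul_monic_left (hc' ▸ c.2)⟩, Subtype.ext hc'.symm⟩
  have h1 : ∑' c, G (m c) = ∑' c, (Set.range m).indicator G c := by
    rw [← tsum_subtype, tsum_range G hm]
  have h2 : ∀ c : {c : F[X] // c.Monic}, (if p ∣ (c : F[X]) then 0 else G c) = (Set.range m)ᶜ.indicator G c := by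
    intro c
    by_cases h : p ∣ (c : F[X])
    · rw [if_pos h, Set.indicator_of_notMem]
      exact not_not.2 ((hrange c).2 h)
    · rw [if_neg h, Set.indicator_of_mem]
      exact fun h' => h ((hrange c).1 h')
  have hs1 : Summable ((Set.range m).indicator G) := hsum.indicator _
  have hs2 : Summable ((Set.range m)ᶜ.indicator G) := hsum.indicator _
  rw [h1, tsum_congr h2, ← hs1.tsum_add hs2]
  refine tsum_congr fun c => ?_
  exact congrFun (Set.indicator_self_add_compl (Set.range m) G) c

end Hecke

section PowerSeriesEvaluation

variable {L : Type*} [NormedField L]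

/-- Norm convergence of the power series `φ` at `u`. -/
def PSConverges (φ : PowerSeries L) (u : L) : Prop :=
  Summable fun n => ‖PowerSeries.coeff n φ * u ^ n‖

/-- The value of the power series `φ` at `u`. -/
def psEval (φ : PowerSeries L) (u : L) : L := ∑' n, PowerSeries.coeff n φ * u ^ n

/-- The coefficients of `φ` grow at most like `ρ ^ n`. -/
def CoeffBound (ρ : ℝ) (φ : PowerSeries L) : Prop := ∀ n, ‖PowerSeries.coeff n φ‖ ≤ ρ ^ n

theorem coeff_mul_mul_pow (φ ψ : PowerSeries L) (u : L) (n : ℕ) :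
    PowerSeries.coeff n (φ * ψ) * u ^ n = ∑ x ∈ Finset.HasAntidiagonal.antidiagonal n,
      PowerSeries.coeff x.1 φ * u ^ x.1 * (PowerSeries.coeff x.2 ψ * u ^ x.2) := by
  rw [PowerSeries.coeff_mul, Finset.sum_mul]
  refine Finset.sum_congr rfl fun x hx => ?_
  rw [← Finset.HasAntidiagonal.mem_antidiagonal.1 hx, pow_add]
  ring

theorem PSConverges.mul {φ ψ : PowerSeries L} {u : L} (hφ : PSConverges φ u)
    (hψ : PSConverges ψ u) : PSConverges (φ * ψ) u := by
  unfold PSConverges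
  simp_rw [coeff_mul_mul_pow]
  exact summable_norm_sum_mul_antidiagonal_of_summable_norm
    (f := fun n => PowerSeries.coeff n φ * u ^ n) (g := fun n => PowerSeries.coeff n ψ * u ^ n) hφ hψ

theorem psEval_mul [CompleteSpace L] {φ ψ : PowerSeries L} {u : L} (hφ : PSConverges φ u)
    (hψ : PSConverges ψ u) : psEval (φ * ψ) u = psEval φ u * psEval ψ u := by
  unfold psEval
  simp_rw [coeff_mul_mul_pow]
  exact (tsum_mul_tsum_eq_tsum_sum_antidiagonal_of_summable_norm
    (f := fun n => PowerSeries.coeff n φ * u ^ n) (g := fun n => PowerSeries.coeff n ψ * u ^ n)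
    hφ hψ).symm

theorem psEval_add [CompleteSpace L] {φ ψ : PowerSeries L} {u : L} (hφ : PSConverges φ u)
    (hψ : PSConverges ψ u) : psEval (φ + ψ) u = psEval φ u + psEval ψ u := by
  unfold psEval
  simp_rw [map_add, add_mul]
  exact (Summable.of_norm hφ).tsum_add (Summable.of_norm hψ)

theorem psConverges_coe (p : L[X]) (u : L) : PSConverges (p : PowerSeries L) u := by
  refine summable_of_ne_finset_zero (s := Finset.range (p.natDegree + 1)) fun n hn => ?_
  rw [Polynomial.coeff_coe, coeff_eq_zero_of_natDegree_lt (by simpa using hn), zero_mul, norm_zero]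

theorem psEval_coe (p : L[X]) (u : L) : psEval (p : PowerSeries L) u = p.eval u := by
  rw [psEval, tsum_eq_sum (s := Finset.range (p.natDegree + 1)), eval_eq_sum_range]
  · simp [Polynomial.coeff_coe]
  · intro n hn
    rw [Polynomial.coeff_coe, coeff_eq_zero_of_natDegree_lt (by simpa using hn), zero_mul]

theorem psConverges_one (u : L) : PSConverges (1 : PowerSeries L) u := by
  simpa using psConverges_coe (1 : L[X]) u

theorem psEval_one (u : L) : psEval (1 : PowerSeries L) u = 1 := by
  simpa using psEval_coe (1 : L[X]) u

theorem PSConverges.pow {φ : PowerSeries L} {u : L} (hφ : PSConverges φ u) (n : ℕ) :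
    PSConverges (φ ^ n) u := by
  induction n with
  | zero => simpa using psConverges_one u
  | succ n ih =>
    rw [pow_succ]
    exact ih.mul hφ

theorem psEval_pow [CompleteSpace L] {φ : PowerSeries L} {u : L} (hφ : PSConverges φ u) (n : ℕ) :
    psEval (φ ^ n) u = psEval φ u ^ n := by
  induction n with
  | zero => simpa using psEval_one u
  | succ n ih => rw [pow_succ, psEval_mul (hφ.pow n) hφ, ih, pow_succ]

theorem CoeffBound.psConverges {ρ : ℝ} (hρ : 0 ≤ ρ) {φ : PowerSeries L} (hφ : CoeffBound ρ φ)
    {u : L} (hu : ρ * ‖u‖ < 1) : PSConverges φ u := by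
  refine Summable.of_nonneg_of_le (fun _ => norm_nonneg _) (fun n => ?_)
    (summable_geometric_of_lt_one (by positivity) hu)
  rw [norm_mul, norm_pow, mul_pow]
  exact mul_le_mul_of_nonneg_right (hφ n) (by positivity)

theorem coeffBound_C_mul_X_pow {ρ : ℝ} (hρ : 0 ≤ ρ) {x : L} {k : ℕ} (hx : ‖x‖ ≤ ρ ^ k) :
    CoeffBound ρ ((C x * X ^ k : L[X]) : PowerSeries L) := by
  intro n
  rw [Polynomial.coeff_coe, coeff_C_mul, coeff_X_pow]
  split_ifs with h
  · rw [mul_one, h]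
    exact hx
  · rw [mul_zero, norm_zero]
    positivity

theorem coeffBound_one {ρ : ℝ} (hρ : 0 ≤ ρ) : CoeffBound ρ (1 : PowerSeries L) := by
  have := coeffBound_C_mul_X_pow hρ (x := (1 : L)) (k := 0) (by simp)
  simpa using this

variable [IsUltrametricDist L]

theorem CoeffBound.norm_psEval_le {ρ : ℝ} (hρ : 0 ≤ ρ) {φ : PowerSeries L} (hφ : CoeffBound ρ φ)
    {u : L} (hu : ρ * ‖u‖ < 1) : ‖psEval φ u‖ ≤ 1 := by
  refine IsUltrametricDist.norm_tsum_le_of_forall_le_of_nonneg zero_le_one fun n => ?_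
  rw [norm_mul, norm_pow]
  calc _ ≤ ρ ^ n * ‖u‖ ^ n := mul_le_mul_of_nonneg_right (hφ n) (by positivity)
    _ = (ρ * ‖u‖) ^ n := (mul_pow _ _ _).symm
    _ ≤ 1 := pow_le_one₀ (by positivity) hu.le

theorem CoeffBound.add {ρ : ℝ} {φ ψ : PowerSeries L} (hφ : CoeffBound ρ φ)
    (hψ : CoeffBound ρ ψ) : CoeffBound ρ (φ + ψ) := by
  intro n
  rw [map_add]
  exact norm_add_le_of_le (hφ n) (hψ n)

theorem CoeffBound.mul {ρ : ℝ} (hρ : 0 ≤ ρ) {φ ψ : PowerSeries L} (hφ : CoeffBound ρ φ)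
    (hψ : CoeffBound ρ ψ) : CoeffBound ρ (φ * ψ) := by
  intro n
  rw [PowerSeries.coeff_mul]
  refine IsUltrametricDist.norm_sum_le_of_forall_le_of_nonneg (by positivity) fun x hx => ?_
  rw [norm_mul, ← Finset.HasAntidiagonal.mem_antidiagonal.1 hx, pow_add]
  exact mul_le_mul (hφ _) (hψ _) (norm_nonneg _) (by positivity)

theorem CoeffBound.pow {ρ : ℝ} (hρ : 0 ≤ ρ) {φ : PowerSeries L} (hφ : CoeffBound ρ φ) (n : ℕ) :
    CoeffBound ρ (φ ^ n) := by
  induction n with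
  | zero => simpa using coeffBound_one hρ
  | succ n ih =>
    rw [pow_succ]
    exact ih.mul hρ hφ

theorem CoeffBound.inv {ρ : ℝ} (hρ : 0 ≤ ρ) {φ : PowerSeries L} (hφ : CoeffBound ρ φ)
    (h1 : PowerSeries.constantCoeff φ = 1) : CoeffBound ρ φ⁻¹ := by
  intro n
  induction n using Nat.strong_induction_on with
  | _ n ih =>
    rw [PowerSeries.coeff_inv, h1]
    split_ifs with h0
    · simp [h0]
    · rw [inv_one, norm_mul, norm_neg, norm_one, one_mul]
      refine IsUltrametricDist.norm_sum_le_of_forall_le_of_nonneg (by positivity) fun x hx => ?_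
      split_ifs with hlt
      · rw [norm_mul, ← Finset.HasAntidiagonal.mem_antidiagonal.1 hx, pow_add]
        exact mul_le_mul (hφ _) (ih _ hlt) (norm_nonneg _) (by positivity)
      · rw [norm_zero]
        positivity

end PowerSeriesEvaluation

section CarlitzExpansion

open Filter Topology

variable {F : Type*} [Field F] [Fintype F]

local notation "q" => Fintype.card F

variable {L : Type*} [NormedField L] (ι : F[X] →+* L)

/-- `e` is additive, `F`-linear and satisfies the functional equation of the Carlitz module. -/
structure IsCarlitzExp (e : L → L) : Prop where
  add : ∀ x y, e (x + y) = e x + e y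
  const_mul : ∀ (ε : F) x, e (ι (C ε) * x) = ι (C ε) * e x
  X_mul : ∀ x, e (ι X * x) = ι X * e x + e x ^ q

variable {ι} [CompleteSpace L] [IsUltrametricDist L]

/-- The reversed Carlitz polynomial: `u ^ (q ^ d) e(c x)` is a power series in `u = 1 / e(x)`. -/
theorem IsCarlitzExp.exists_series {e : L → L} (he : IsCarlitzExp ι e) (hι : IsNormEmbedding ι)
    (d : ℕ) {c : F[X]} (hc : c.Monic) (hd : c.natDegree = d) : ∃ g : PowerSeries L,
    CoeffBound q g ∧ PowerSeries.constantCoeff g = 1 ∧ ∀ x, e x ≠ 0 → (q : ℝ) * ‖(e x)⁻¹‖ < 1 →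
      psEval g (e x)⁻¹ = ((e x)⁻¹) ^ q ^ d * e (ι c * x) := by
  have hq := one_lt_q F
  have hq0 : (0 : ℝ) ≤ q := (zero_lt_one.trans hq).le
  have hq' : 1 < q := Fintype.one_lt_card
  induction d generalizing c with
  | zero =>
    have h1 : c = 1 := hc.natDegree_eq_zero.1 hd
    refine ⟨1, coeffBound_one hq0, by simp, fun x hx _ => ?_⟩
    rw [psEval_one, h1]
    simp [hx]
  | succ d ih =>
    have hc' : c.divX.Monic := by
      rw [Monic, leadingCoeff, natDegree_divX_eq_natDegree_tsub_one, coeff_divX,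
        Nat.sub_add_cancel (by omega)]
      exact hc
    obtain ⟨g, hg, hg1, hge⟩ := ih hc' (by rw [natDegree_divX_eq_natDegree_tsub_one]; omega)
    set ε := c.coeff 0 with hε
    have hlt : q ^ d < q ^ (d + 1) := Nat.pow_lt_pow_right hq' (Nat.lt_succ_self d)
    have hpos : 0 < q ^ d := by positivity
    set P₁ : L[X] := C (ι X) * X ^ (q ^ (d + 1) - q ^ d) with hP₁
    set P₂ : L[X] := C (ι (C ε)) * X ^ (q ^ (d + 1) - 1) with hP₂
    have hb1 : CoeffBound q (P₁ : PowerSeries L) := by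
      refine coeffBound_C_mul_X_pow hq0 ?_
      rw [hι X X_ne_zero, natDegree_X]
      exact pow_le_pow_right₀ hq.le (by omega)
    have hb2 : CoeffBound q (P₂ : PowerSeries L) := by
      refine coeffBound_C_mul_X_pow hq0 ?_
      by_cases h0 : ε = 0
      · rw [h0, C_0, map_zero, norm_zero]
        positivity
      · rw [hι _ (C_ne_zero.2 h0), natDegree_C, pow_zero]
        exact one_le_pow₀ hq.le
    refine ⟨P₁ * g + g ^ q + P₂, ((hb1.mul hq0 hg).add (hg.pow hq0 _)).add hb2, ?_, ?_⟩
    · have h1 : PowerSeries.constantCoeff (P₁ : PowerSeries L) = 0 := by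
        rw [← PowerSeries.coeff_zero_eq_constantCoeff_apply, Polynomial.coeff_coe, hP₁, coeff_C_mul,
          coeff_X_pow, if_neg (by omega), mul_zero]
      have h2 : PowerSeries.constantCoeff (P₂ : PowerSeries L) = 0 := by
        rw [← PowerSeries.coeff_zero_eq_constantCoeff_apply, Polynomial.coeff_coe, hP₂, coeff_C_mul,
          coeff_X_pow, if_neg (by omega), mul_zero]
      simp [h1, h2, hg1]
    · intro x hx hu
      set u := (e x)⁻¹ with hudef
      have hgc := hg.psConverges hq0 hu
      have hP1c := psConverges_coe P₁ u
      have hadd : PSConverges ((P₁ : PowerSeries L) * g + g ^ q) u :=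
        ((hb1.mul hq0 hg).add (hg.pow hq0 _)).psConverges hq0 hu
      rw [psEval_add hadd (psConverges_coe P₂ u), psEval_add (hP1c.mul hgc) (hgc.pow _),
        psEval_mul hP1c hgc, psEval_pow hgc, psEval_coe, psEval_coe, hge x hx hu, hP₁, hP₂]
      simp only [eval_mul, eval_C, eval_pow, eval_X]
      have hcx : e (ι c * x) = ι X * e (ι c.divX * x) + e (ι c.divX * x) ^ q + ι (C ε) * e x := by
        rw [← he.X_mul, ← he.const_mul, ← he.add]
        congr 1
        have := congrArg ι (divX_mul_X_add c)
        rw [map_add, map_mul] at this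
        rw [← this]
        ring
      have hu0 : u ≠ 0 := inv_ne_zero hx
      have e1 : u ^ (q ^ (d + 1) - q ^ d) * u ^ q ^ d = u ^ q ^ (d + 1) := by
        rw [← pow_add]
        congr 1
        omega
      have e2 : u ^ (q ^ (d + 1) - 1) = u ^ q ^ (d + 1) * e x := by
        rw [← inv_inv (e x), ← hudef, eq_mul_inv_iff_mul_eq₀ hu0, ← pow_succ]
        congr 1
        omega
      rw [hcx, mul_pow, ← pow_mul, ← pow_succ, e2]
      linear_combination ι X * e (ι c.divX * x) * e1

theorem IsCarlitzExp.exists_series_inv {e : L → L} (he : IsCarlitzExp ι e) (hι : IsNormEmbedding ι)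
    {c : F[X]} (hc : c.Monic) : ∃ h : PowerSeries L,
    CoeffBound q h ∧ ∀ x, e x ≠ 0 → (q : ℝ) * ‖(e x)⁻¹‖ < 1 →
      (e (ι c * x))⁻¹ = ((e x)⁻¹) ^ q ^ c.natDegree * psEval h (e x)⁻¹ := by
  have hq0 : (0 : ℝ) ≤ q := (zero_lt_one.trans (one_lt_q F)).le
  obtain ⟨g, hg, hg1, hge⟩ := he.exists_series hι c.natDegree hc rfl
  have hinv := hg.inv hq0 hg1
  refine ⟨g⁻¹, hinv, fun x hx hu => ?_⟩
  have h1 : psEval g (e x)⁻¹ * psEval g⁻¹ (e x)⁻¹ = 1 := by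
    rw [← psEval_mul (hg.psConverges hq0 hu) (hinv.psConverges hq0 hu),
      PowerSeries.mul_inv_cancel g (by rw [hg1]; exact one_ne_zero), psEval_one]
  rw [hge x hx hu] at h1
  refine inv_eq_of_mul_eq_one_right ?_
  linear_combination h1

theorem tendsto_pow_mul_pow_cofinite (Q : ℕ) {t : ℝ} (h0 : 0 ≤ t) (h1 : t < 1) :
    Tendsto (fun x : {c : F[X] // c.Monic} × ℕ => open Classical in
      if q ^ (x.1 : F[X]).natDegree ≤ x.2 then (x.2 : ℝ) ^ Q * t ^ x.2 else 0) cofinite (𝓝 0) := by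
  classical
  have hlim : Tendsto (fun n : ℕ => (n : ℝ) ^ Q * t ^ n) atTop (𝓝 0) :=
    tendsto_pow_const_mul_const_pow_of_lt_one Q h0 h1
  rw [Metric.tendsto_nhds]
  intro ε hε
  obtain ⟨n₀, hn₀⟩ := eventually_atTop.1 (Metric.tendsto_nhds.1 hlim ε hε)
  refine eventually_cofinite.2 ?_
  have hfin : ((Subtype.val ⁻¹' {a : F[X] | a.degree < n₀} : Set {c : F[X] // c.Monic}) ×ˢ
      (Set.Iio n₀ : Set ℕ)).Finite :=
    ((finite_degree_lt F n₀).preimage Subtype.val_injective.injOn).prod (Set.finite_Iio n₀)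
  refine hfin.subset ?_
  rintro ⟨c, n⟩ hx
  simp only [Set.mem_ofPred_eq] at hx
  split_ifs at hx with h
  · have hn : n < n₀ := by
      by_contra hn
      exact hx (hn₀ n (not_lt.1 hn))
    refine ⟨?_, hn⟩
    refine (natDegree_lt_iff_degree_lt c.2.ne_zero).1 ?_
    exact (Nat.lt_pow_self Fintype.one_lt_card).trans (h.trans_lt hn)
  · rw [dist_self] at hx
    exact absurd hε hx

/-- The `A`-expansion `∑ c ^ Q / e(c x)` is a power series in `u = 1 / e(x)`. -/
theorem IsCarlitzExp.exists_expansion {e : L → L} (he : IsCarlitzExp ι e) (hι : IsNormEmbedding ι)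
    (Q : ℕ) : ∃ φ : PowerSeries L, ∀ x, e x ≠ 0 → (q : ℝ) * ‖(e x)⁻¹‖ < 1 →
      PSConverges φ (e x)⁻¹ ∧
        psEval φ (e x)⁻¹ = ∑' c : {c : F[X] // c.Monic}, ι c ^ Q * (e (ι c * x))⁻¹ := by
  classical
  have hq := one_lt_q F
  have hq0 : (0 : ℝ) ≤ q := (zero_lt_one.trans hq).le
  choose h hh hhe using fun c : {c : F[X] // c.Monic} => he.exists_series_inv hι c.2
  set b : {c : F[X] // c.Monic} → PowerSeries L := fun c =>
    ((C (ι c ^ Q) * X ^ q ^ (c : F[X]).natDegree : L[X]) : PowerSeries L) * h c with hb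
  have hcoeff : ∀ c n, PowerSeries.coeff n (b c) = if q ^ (c : F[X]).natDegree ≤ n then
      ι c ^ Q * PowerSeries.coeff (n - q ^ (c : F[X]).natDegree) (h c) else 0 := by
    intro c n
    simp only [hb, Polynomial.coe_mul, Polynomial.coe_C, Polynomial.coe_pow, Polynomial.coe_X,
      mul_assoc, PowerSeries.coeff_C_mul, PowerSeries.coeff_X_pow_mul']
    split_ifs <;> simp
  have hbound : ∀ c n, ‖PowerSeries.coeff n (b c)‖ ≤
      if q ^ (c : F[X]).natDegree ≤ n then (n : ℝ) ^ Q * (q : ℝ) ^ n else 0 := by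
    intro c n
    rw [hcoeff]
    split_ifs with hn
    · rw [norm_mul, norm_pow, hι c c.2.ne_zero]
      refine mul_le_mul ?_ ((hh c _).trans (pow_le_pow_right₀ hq.le (Nat.sub_le _ _)))
        (norm_nonneg _) (by positivity)
      exact pow_le_pow_left₀ (by positivity) (by exact_mod_cast hn) Q
    · simp
  have hsupp : ∀ n, Summable fun c => PowerSeries.coeff n (b c) := by
    intro n
    refine summable_of_hasFiniteSupport (((finite_degree_lt F (n + 1)).preimage
      (f := Subtype.val) Subtype.val_injective.injOn).subset fun c hc => ?_)
    refine (natDegree_lt_iff_degree_lt c.2.ne_zero).1 ?_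
    by_contra hlt
    refine hc ?_
    simp only
    rw [hcoeff, if_neg]
    have := Nat.lt_pow_self (n := (c : F[X]).natDegree) (Fintype.one_lt_card (α := F))
    omega
  set φ : PowerSeries L := PowerSeries.mk fun n => ∑' c, PowerSeries.coeff n (b c) with hφ
  have hφn : ∀ n, ‖PowerSeries.coeff n φ‖ ≤ (n : ℝ) ^ Q * (q : ℝ) ^ n := by
    intro n
    rw [hφ, PowerSeries.coeff_mk]
    refine IsUltrametricDist.norm_tsum_le_of_forall_le_of_nonneg (by positivity) fun c => ?_
    refine (hbound c n).trans ?_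
    split_ifs
    · exact le_rfl
    · positivity
  refine ⟨φ, fun x hx hu => ?_⟩
  set u := (e x)⁻¹ with hudef
  have ht0 : 0 ≤ (q : ℝ) * ‖u‖ := by positivity
  refine ⟨?_, ?_⟩
  · have hgeo : Summable fun n : ℕ => (n : ℝ) ^ Q * ((q : ℝ) * ‖u‖) ^ n :=
      summable_pow_mul_geometric_of_norm_lt_one Q (by rwa [Real.norm_of_nonneg ht0])
    refine Summable.of_nonneg_of_le (fun _ => norm_nonneg _) (fun n => ?_) hgeo
    rw [norm_mul, norm_pow, mul_pow, ← mul_assoc]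
    exact mul_le_mul_of_nonneg_right (hφn n) (by positivity)
  · set f : {c : F[X] // c.Monic} × ℕ → L := fun x => PowerSeries.coeff x.2 (b x.1) * u ^ x.2
    have hf : Summable f := by
      refine summable_of_norm_le (tendsto_pow_mul_pow_cofinite Q ht0 hu) fun x => ?_
      rw [norm_mul, norm_pow]
      refine (mul_le_mul_of_nonneg_right (hbound x.1 x.2) (by positivity)).trans ?_
      split_ifs
      · rw [mul_pow, mul_assoc]
      · rw [zero_mul]
    have h1 : HasSum (fun c : {c : F[X] // c.Monic} => ι c ^ Q * (e (ι c * x))⁻¹) (∑' x, f x) := by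
      refine hf.hasSum.prod_fiberwise fun c => ?_
      have hpc := psConverges_coe (C (ι c ^ Q) * X ^ q ^ (c : F[X]).natDegree : L[X]) u
      have hhc := (hh c).psConverges hq0 hu
      have hval : psEval (b c) u = ι c ^ Q * (e (ι c * x))⁻¹ := by
        rw [hb, psEval_mul hpc hhc, psEval_coe, hhe c x hx hu]
        simp only [eval_mul, eval_C, eval_pow, eval_X]
        ring
      rw [← hval]
      exact (Summable.of_norm (hpc.mul hhc)).hasSum
    have h2 : HasSum (fun n => PowerSeries.coeff n φ * u ^ n) (∑' x, f x) := by
      have hsw := ((Equiv.prodComm ℕ {c : F[X] // c.Monic}).hasSum_iff (f := f)).2 hf.hasSum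
      refine hsw.prod_fiberwise fun n => ?_
      rw [hφ, PowerSeries.coeff_mk]
      exact (hsupp n).hasSum.mul_right (u ^ n)
    rw [psEval, h2.tsum_eq, h1.tsum_eq]

/-- Where `1 / e(x)` is small, it dominates the other terms of the `A`-expansion. -/
theorem IsCarlitzExp.tsum_ne_zero {e : L → L} (he : IsCarlitzExp ι e) (hι : IsNormEmbedding ι)
    (Q : ℕ) {x : L} (hx : e x ≠ 0) (hu : ‖(e x)⁻¹‖ ≤ ((q : ℝ) ^ (Q + 2))⁻¹)
    (hs : Summable fun c : {c : F[X] // c.Monic} => ι c ^ Q * (e (ι c * x))⁻¹) :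
    ∑' c : {c : F[X] // c.Monic}, ι c ^ Q * (e (ι c * x))⁻¹ ≠ 0 := by
  classical
  have hq := one_lt_q F
  have hq0 : (0 : ℝ) < q := zero_lt_one.trans hq
  have hq' : 1 < q := Fintype.one_lt_card
  set u := (e x)⁻¹ with hudef
  have hu0 : 0 < ‖u‖ := norm_pos_iff.2 (inv_ne_zero hx)
  have hu1 : (q : ℝ) * ‖u‖ < 1 := by
    refine (mul_le_mul_of_nonneg_left hu hq0.le).trans_lt ?_
    rw [← div_eq_mul_inv, div_lt_one (by positivity)]
    calc (q : ℝ) = (q : ℝ) ^ 1 := (pow_one _).symm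
      _ < (q : ℝ) ^ (Q + 2) := pow_lt_pow_right₀ hq (by omega)
  set one : {c : F[X] // c.Monic} := ⟨1, monic_one⟩
  rw [hs.tsum_eq_add_tsum_ite one]
  have htail : ‖∑' c : {c : F[X] // c.Monic},
      if c = one then 0 else ι c ^ Q * (e (ι c * x))⁻¹‖ ≤ ‖u‖ * (q : ℝ)⁻¹ := by
    refine IsUltrametricDist.norm_tsum_le_of_forall_le_of_nonneg (by positivity) fun c => ?_
    split_ifs with hc
    · rw [norm_zero]
      positivity
    · obtain ⟨h, hh, hhe⟩ := he.exists_series_inv hι c.2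
      have hd : (c : F[X]).natDegree ≠ 0 := fun h0 =>
        hc (Subtype.ext (c.2.natDegree_eq_zero.1 h0))
      set d := (c : F[X]).natDegree
      have hdq : d + 1 ≤ q ^ d := Nat.lt_pow_self hq'
      obtain ⟨k, hk⟩ : ∃ k, q ^ d = k + 1 := ⟨q ^ d - 1, by omega⟩
      have hb : ‖(e (ι c * x))⁻¹‖ ≤ ‖u‖ * ‖u‖ ^ k := by
        rw [hhe x hx hu1, norm_mul, norm_pow, hk, pow_succ']
        exact mul_le_of_le_one_right (by positivity) (hh.norm_psEval_le hq0.le hu1)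
      have hk2 : ‖u‖ ^ k ≤ ((q : ℝ) ^ ((Q + 2) * k))⁻¹ := by
        rw [pow_mul, ← inv_pow]
        exact pow_le_pow_left₀ hu0.le hu k
      rw [norm_mul, norm_pow, hι c c.2.ne_zero, ← pow_mul]
      calc (q : ℝ) ^ (d * Q) * ‖(e (ι c * x))⁻¹‖
          ≤ (q : ℝ) ^ (d * Q) * (‖u‖ * ((q : ℝ) ^ ((Q + 2) * k))⁻¹) := by
            gcongr
            exact hb.trans (by gcongr)
        _ = ‖u‖ * ((q : ℝ) ^ (d * Q) * ((q : ℝ) ^ ((Q + 2) * k))⁻¹) := by ring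
        _ ≤ ‖u‖ * (q : ℝ)⁻¹ := by
          gcongr
          rw [← div_eq_mul_inv, div_le_iff₀ (by positivity), inv_mul_eq_div, le_div_iff₀ hq0,
            ← pow_succ]
          refine pow_le_pow_right₀ hq.le ?_
          have := Nat.mul_le_mul_right Q (show d ≤ k by omega)
          have : (Q + 2) * k = k * Q + 2 * k := by ring
          omega
  have hone : ι (one : F[X]) ^ Q * (e (ι (one : F[X]) * x))⁻¹ = u := by
    simp [one, hudef]
  rw [hone]
  intro h0
  rw [add_eq_zero_iff_eq_neg] at h0
  rw [← norm_neg, ← h0] at htail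
  have : ‖u‖ * (q : ℝ)⁻¹ < ‖u‖ := mul_lt_of_lt_one_right hu0 (inv_lt_one_of_one_lt₀ hq)
  linarith

end CarlitzExpansion

section RationalApproximation

open Filter Topology

variable {L : Type*} [NormedField L]

/-- On `S`, `g` is a rational function without poles in `S`. -/
def IsRatOn (S : Set L) (g : L → L) : Prop :=
  ∃ P Q : L[X], ∀ z ∈ S, Q.eval z ≠ 0 ∧ g z = P.eval z / Q.eval z

/-- On `S`, `g` is a uniform limit of rational functions without poles in `S`. -/
def IsRatLimitOn (S : Set L) (g : L → L) : Prop :=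
  ∀ ε : ℝ, 0 < ε → ∃ P Q : L[X], ∀ z ∈ S, Q.eval z ≠ 0 ∧ ‖g z - P.eval z / Q.eval z‖ ≤ ε

theorem isRatOn_zero (S : Set L) : IsRatOn S fun _ => 0 := ⟨0, 1, fun z _ => by simp⟩

theorem IsRatOn.add {S : Set L} {f g : L → L} (hf : IsRatOn S f) (hg : IsRatOn S g) :
    IsRatOn S fun z => f z + g z := by
  obtain ⟨P₁, Q₁, h₁⟩ := hf
  obtain ⟨P₂, Q₂, h₂⟩ := hg
  refine ⟨P₁ * Q₂ + Q₁ * P₂, Q₁ * Q₂, fun z hz => ?_⟩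
  simp only
  rw [eval_mul, eval_add, eval_mul, eval_mul, (h₁ z hz).2, (h₂ z hz).2,
    div_add_div _ _ (h₁ z hz).1 (h₂ z hz).1]
  exact ⟨mul_ne_zero (h₁ z hz).1 (h₂ z hz).1, rfl⟩

theorem IsRatOn.sum {S : Set L} {α : Type*} (s : Finset α) {f : α → L → L}
    (hf : ∀ i ∈ s, IsRatOn S (f i)) : IsRatOn S fun z => ∑ i ∈ s, f i z := by
  classical
  induction s using Finset.induction_on with
  | empty => simpa using isRatOn_zero S
  | insert a s ha ih =>
    simp_rw [Finset.sum_insert ha]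
    exact (hf a (Finset.mem_insert_self a s)).add
      (ih fun i hi => hf i (Finset.mem_insert_of_mem hi))

theorem IsRatLimitOn.const_mul {S : Set L} {g : L → L} (hg : IsRatLimitOn S g) (x : L) :
    IsRatLimitOn S fun z => x * g z := by
  intro ε hε
  obtain ⟨P, Q, h⟩ := hg (ε / (‖x‖ + 1)) (by positivity)
  refine ⟨C x * P, Q, fun z hz => ⟨(h z hz).1, ?_⟩⟩
  rw [eval_mul, eval_C, mul_div_assoc, ← mul_sub, norm_mul]
  refine (mul_le_mul_of_nonneg_left (h z hz).2 (norm_nonneg x)).trans ?_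
  rw [mul_div_assoc', div_le_iff₀ (by positivity)]
  nlinarith [norm_nonneg x]

theorem norm_pow_sub_pow_le [IsUltrametricDist L] {x y : L} {M ε : ℝ} (hM : 1 ≤ M) (hx : ‖x‖ ≤ M)
    (hy : ‖y‖ ≤ M) (hxy : ‖x - y‖ ≤ ε) (k : ℕ) : ‖x ^ k - y ^ k‖ ≤ M ^ k * ε := by
  have hε : 0 ≤ ε := (norm_nonneg _).trans hxy
  induction k with
  | zero => simpa using hε
  | succ k ih =>
    rw [show x ^ (k + 1) - y ^ (k + 1) = x * (x ^ k - y ^ k) + y ^ k * (x - y) by ring]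
    refine norm_add_le_of_le ?_ ?_
    · rw [norm_mul, pow_succ', mul_assoc]
      exact mul_le_mul hx ih (norm_nonneg _) (by positivity)
    · rw [norm_mul, norm_pow]
      refine mul_le_mul ?_ hxy (norm_nonneg _) (by positivity)
      exact (pow_le_pow_left₀ (norm_nonneg y) hy k).trans (pow_le_pow_right₀ hM (Nat.le_succ k))

theorem IsRatLimitOn.pow [IsUltrametricDist L] {S : Set L} {g : L → L} (hg : IsRatLimitOn S g)
    {M : ℝ} (hM : ∀ z ∈ S, ‖g z‖ ≤ M) (k : ℕ) : IsRatLimitOn S fun z => g z ^ k := by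
  intro ε hε
  set B := max 1 M
  have hB : 1 ≤ B := le_max_left _ _
  have hB0 : 0 < B := zero_lt_one.trans_le hB
  obtain ⟨P, Q, h⟩ := hg (min 1 (ε / B ^ k)) (by positivity)
  refine ⟨P ^ k, Q ^ k, fun z hz => ⟨?_, ?_⟩⟩
  · rw [eval_pow]
    exact pow_ne_zero k (h z hz).1
  · rw [eval_pow, eval_pow, ← div_pow]
    have hgB : ‖g z‖ ≤ B := (hM z hz).trans (le_max_right _ _)
    have hPB : ‖P.eval z / Q.eval z‖ ≤ B := by
      rw [← sub_sub_cancel (g z) (P.eval z / Q.eval z)]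
      exact norm_sub_le_of_le hgB (((h z hz).2.trans (min_le_left _ _)).trans hB)
    refine (norm_pow_sub_pow_le hB hgB hPB ((h z hz).2.trans (min_le_right _ _)) k).trans_eq ?_
    field_simp

variable {F : Type*} [Field F] [Fintype F]

local notation "q" => Fintype.card F

variable {ι : F[X] →+* L}

theorem isRatOn_aQuotFin (hι : IsNormEmbedding ι) {S : Set L} {r : ℝ} (hr : 0 < r)
    (hS : ∀ z ∈ S, FarFromK ι r z) (Q N : ℕ) {c : F[X]} (hc : c ≠ 0) :
    IsRatOn S fun z => aQuotFin ι Q N z c := by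
  refine ⟨C (ι c ^ Q * latConst ι N), ∏ a ∈ degLT F N, (C (ι c) * X + C (ι a)), fun z hz => ?_⟩
  have h : (∏ a ∈ degLT F N, (C (ι c) * X + C (ι a))).eval z = latProd ι N (ι c * z) := by
    rw [eval_prod, latProd]
    simp
  rw [h]
  constructor
  · refine Finset.prod_ne_zero_iff.2 fun a _ => norm_pos_iff.1 (lt_of_lt_of_le ?_ (hS z hz c a))
    exact mul_pos hr (norm_pos_iff.2 (hι.ne_zero hc))
  · simp only
    rw [eval_C, aQuotFin, latExp, div_div_eq_mul_div]

variable [CompleteSpace L] [IsUltrametricDist L]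

theorem norm_aQuot_sub_aQuotFin_le (hι : IsNormEmbedding ι) {r R : ℝ} (hr : 0 < r) {z : L}
    (hz : FarFromK ι r z) (hR : ‖z‖ ≤ R) (Q : ℕ) {c : F[X]} (hc : c ≠ 0) {D N : ℕ}
    (hcD : c.natDegree ≤ D) (hN : (q : ℝ) ^ D * R ≤ (q : ℝ) ^ N) :
    ‖aQuot ι Q z c - aQuotFin ι Q N z c‖ ≤ ((q : ℝ) ^ D) ^ Q * ((q : ℝ) ^ D * R) / r / (q : ℝ) ^ N := by
  have hq := one_lt_q F
  have hq0 : (0 : ℝ) < q := zero_lt_one.trans hq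
  have hcq : ‖ι c‖ ≤ (q : ℝ) ^ D := by
    rw [hι c hc]
    exact pow_le_pow_right₀ hq.le hcD
  have hcz : ‖ι c * z‖ ≤ (q : ℝ) ^ D * R := by
    rw [norm_mul]
    exact mul_le_mul hcq hR (norm_nonneg _) (by positivity)
  set E := latticeFun ι (ι c * z) with hE
  set e := latExp ι N (ι c * z) with he
  have hrE : r ≤ ‖E‖ := le_norm_latticeFun_mul' hι hr hz hc
  have hE0 : E ≠ 0 := norm_pos_iff.1 (hr.trans_le hrE)
  have hre : r * ‖ι c‖ ≤ ‖e‖ := by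
    simpa using le_norm_latExp hι (m := 0) (fun a _ => hz c a) (Nat.zero_le N) (by omega)
  have he0 : e ≠ 0 := norm_pos_iff.1
    ((mul_pos hr (norm_pos_iff.2 (hι.ne_zero hc))).trans_le hre)
  have hdiff : ‖E - e‖ ≤ ‖e‖ * (‖ι c * z‖ / (q : ℝ) ^ N) :=
    norm_latticeFun_sub_le hι (hcz.trans hN)
  have hepos := norm_pos_iff.2 he0
  rw [aQuot, aQuotFin, ← hE, ← he, show ι c ^ Q / E - ι c ^ Q / e = -(ι c ^ Q * ((E - e) / e / E)) by
    field_simp; ring, norm_neg, norm_mul, norm_div, norm_div, norm_pow]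
  have h1 : ‖E - e‖ / ‖e‖ ≤ (q : ℝ) ^ D * R / (q : ℝ) ^ N := by
    rw [div_le_iff₀ hepos, mul_comm]
    refine hdiff.trans ?_
    gcongr
  have hR0 : 0 ≤ R := (norm_nonneg z).trans hR
  calc ‖ι c‖ ^ Q * (‖E - e‖ / ‖e‖ / ‖E‖)
      ≤ ((q : ℝ) ^ D) ^ Q * ((q : ℝ) ^ D * R / (q : ℝ) ^ N / r) := by gcongr
    _ = ((q : ℝ) ^ D) ^ Q * ((q : ℝ) ^ D * R) / r / (q : ℝ) ^ N := by ring

theorem isRatLimitOn_aSum (hι : IsNormEmbedding ι) {S : Set L} {r R : ℝ} (hr : 0 < r)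
    (hS : ∀ z ∈ S, FarFromK ι r z) (hR : ∀ z ∈ S, ‖z‖ ≤ R) (Q : ℕ) :
    IsRatLimitOn S (aSum ι Q) := by
  classical
  intro ε hε
  have hq := one_lt_q F
  obtain ⟨s, hs⟩ := exists_one_le_mul_pow (F := F) hr
  obtain ⟨D, hD⟩ := eventually_atTop.1 ((tendsto_decayBound (F := F) hr s Q).eventually
    (gt_mem_nhds hε))
  obtain ⟨N₁, hN₁⟩ := pow_unbounded_of_one_lt ((q : ℝ) ^ D * R) hq
  obtain ⟨N₂, hN₂⟩ := pow_unbounded_of_one_lt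
    (((q : ℝ) ^ D) ^ Q * ((q : ℝ) ^ D * R) / r / ε) hq
  set N := max N₁ N₂
  have hNR : (q : ℝ) ^ D * R ≤ (q : ℝ) ^ N :=
    hN₁.le.trans (pow_le_pow_right₀ hq.le (le_max_left _ _))
  have hNε : ((q : ℝ) ^ D) ^ Q * ((q : ℝ) ^ D * R) / r / (q : ℝ) ^ N ≤ ε := by
    have h := hN₂.le.trans (pow_le_pow_right₀ hq.le (le_max_right N₁ N₂))
    rw [div_le_iff₀ hε] at h
    rw [div_le_iff₀ (by positivity), mul_comm ε]
    exact h
  obtain ⟨P, P', hP⟩ := IsRatOn.sum (S := S) (monicLT F D) (f := fun c z => aQuotFin ι Q N z c)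
    fun c hc => isRatOn_aQuotFin hι hr hS Q N (mem_monicLT.1 hc).2.ne_zero
  simp only at hP
  refine ⟨P, P', fun z hz => ⟨(hP z hz).1, ?_⟩⟩
  have hfin : ∑ c ∈ monicLT F D, aQuotFin ι Q N z c = ∑' c : {c : F[X] // c.Monic},
      if (c : F[X]) ∈ monicLT F D then aQuotFin ι Q N z c else 0 := by
    rw [tsum_eq_sum (s := (monicLT F D).subtype fun c => c.Monic)]
    · rw [Finset.sum_congr rfl fun c hc => if_pos (Finset.mem_subtype.1 hc)]
      exact (Finset.sum_subtype_of_mem (fun c => aQuotFin ι Q N z c)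
        fun c hc => (mem_monicLT.1 hc).2).symm
    · intro c hc
      rw [Finset.mem_subtype] at hc
      rw [if_neg hc]
  have hsumm : Summable fun c : {c : F[X] // c.Monic} =>
      if (c : F[X]) ∈ monicLT F D then aQuotFin ι Q N z c else 0 := by
    refine summable_of_ne_finset_zero (s := (monicLT F D).subtype fun c => c.Monic) fun c hc => ?_
    rw [Finset.mem_subtype] at hc
    rw [if_neg hc]
  have hsum := summable_aQuot_pow hι hr (hS z hz) Q le_rfl
  simp only [pow_one] at hsum
  rw [← (hP z hz).2, hfin, aSum, ← hsum.tsum_sub hsumm]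
  refine IsUltrametricDist.norm_tsum_le_of_forall_le_of_nonneg hε.le fun c => ?_
  split_ifs with h
  · exact (norm_aQuot_sub_aQuotFin_le hι hr (hS z hz) (hR z hz) Q c.2.ne_zero
      (mem_monicLT_iff.1 h).1.le hNR).trans hNε
  · rw [sub_zero]
    refine (norm_aQuot_le hι hr hs (hS z hz) Q c.2.ne_zero).trans (hD _ ?_).le
    by_contra hlt
    exact h (mem_monicLT_iff.2 ⟨not_le.1 hlt, c.2⟩)

theorem exists_norm_aSum_le (hι : IsNormEmbedding ι) {S : Set L} {r : ℝ} (hr : 0 < r)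
    (hS : ∀ z ∈ S, FarFromK ι r z) (Q : ℕ) : ∃ M, ∀ z ∈ S, ‖aSum ι Q z‖ ≤ M := by
  obtain ⟨s, hs⟩ := exists_one_le_mul_pow (F := F) hr
  obtain ⟨M, hM⟩ := (tendsto_decayBound (F := F) hr s Q).bddAbove_range
  refine ⟨max M 0, fun z hz => ?_⟩
  refine IsUltrametricDist.norm_tsum_le_of_forall_le_of_nonneg (le_max_right _ _) fun c => ?_
  refine (norm_aQuot_le hι hr hs (hS z hz) Q c.2.ne_zero).trans (le_max_of_le_left ?_)
  exact hM ⟨_, rfl⟩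

end RationalApproximation

section ConcreteFields

variable {F : Type*} [Field F] [Fintype F]

local notation "q" => Fintype.card F

instance KInfAlg.isUltrametricDist : IsUltrametricDist (KInfAlg F) :=
  IsUltrametricDist.isUltrametricDist_of_isNonarchimedean_norm
    (isNonarchimedean_spectralNorm (K := KInf F) (L := KInfAlg F))

instance CInf.isUltrametricDist : IsUltrametricDist (CInf F) := by
  refine IsUltrametricDist.isUltrametricDist_of_forall_norm_add_le_max_norm fun x y => ?_
  refine UniformSpace.Completion.induction_on₂ x y ?_ ?_
  · exact isClosed_le (by fun_prop) (by fun_prop)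
  · intro a b
    rw [← UniformSpace.Completion.coe_add]
    simp only [UniformSpace.Completion.norm_coe]
    exact IsUltrametricDist.norm_add_le_max a b

theorem norm_ofKInf (x : KInf F) : ‖ofKInf F x‖ = ‖x‖ := by
  change ‖((algebraMap (KInf F) (KInfAlg F) x : KInfAlg F) : CInf F)‖ = ‖x‖
  rw [UniformSpace.Completion.norm_coe]
  exact spectralNorm_extends x

theorem norm_polyToKInf {a : F[X]} (ha : a ≠ 0) : ‖polyToKInf F a‖ = (q : ℝ) ^ a.natDegree := by
  change ‖((WithAbs.toAbs (absInfty F) (algebraMap F[X] (RatFunc F) a) : WithAbs (absInfty F)) :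
    KInf F)‖ = _
  rw [UniformSpace.Completion.norm_coe]
  change absInftyFun F (algebraMap F[X] (RatFunc F) a) = _
  have h0 : algebraMap F[X] (RatFunc F) a ≠ 0 := by simpa using ha
  rw [absInftyFun, if_neg h0, RatFunc.intDegree_polynomial, zpow_natCast]

theorem isNormEmbedding_ofPoly : IsNormEmbedding (ofPoly : F[X] →+* CInf F) := by
  intro a ha
  rw [ofPoly_eq, norm_ofKInf, norm_polyToKInf ha]

theorem isClosed_range_ofKInf : IsClosed (Set.range (ofKInf F)) := by
  have h : Isometry (ofKInf F) := AddMonoidHomClass.isometry_of_norm (ofKInf F) norm_ofKInf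
  exact h.isClosedEmbedding.isClosed_range

theorem imDist_pos (z : Omega F) : 0 < imDist (z : CInf F) :=
  (isClosed_range_ofKInf.notMem_iff_infDist_pos (Set.range_nonempty _)).1 z.2

theorem farFromK_of_le_imDist {z : CInf F} {r : ℝ} (hz : r ≤ imDist z) :
    FarFromK (ofPoly : F[X] →+* CInf F) r z := by
  intro c a
  by_cases hc : c = 0
  · simp [hc]
  have hc0 : ofPoly c ≠ 0 := isNormEmbedding_ofPoly.ne_zero hc
  have hmem : ofKInf F (-polyToKInf F a / polyToKInf F c) ∈ Set.range (ofKInf F) := ⟨_, rfl⟩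
  have h := hz.trans (Metric.infDist_le_dist_of_mem (x := z) hmem)
  rw [dist_eq_norm, map_div₀, map_neg, ← ofPoly_eq, ← ofPoly_eq] at h
  have e : ofPoly c * z + ofPoly a = (z - -ofPoly a / ofPoly c) * ofPoly c := by
    field_simp
    ring
  rw [e, norm_mul]
  gcongr

theorem farFromK_omega (z : Omega F) : FarFromK (ofPoly : F[X] →+* CInf F) (imDist (z : CInf F)) z :=
  farFromK_of_le_imDist le_rfl

theorem exists_zpow_norm_eq {x : KInf F} (hx : x ≠ 0) : ∃ n : ℤ, ‖x‖ = (q : ℝ) ^ n := by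
  have hpos : 0 < ‖x‖ := norm_pos_iff.2 hx
  obtain ⟨a, ha⟩ := (UniformSpace.Completion.denseRange_coe (α := WithAbs (absInfty F))).exists_dist_lt
    x hpos
  rw [dist_eq_norm] at ha
  have h1 : ‖(a : KInf F)‖ = ‖x‖ := by
    have h2 : (a : KInf F) = x + -(x - a) := by ring
    rw [h2]
    rw [IsUltrametricDist.norm_add_eq_max_of_norm_ne_norm (by rw [norm_neg]; exact ha.ne'),
      norm_neg, max_eq_left ha.le]
  rw [UniformSpace.Completion.norm_coe] at h1
  change absInftyFun F a.ofAbs = ‖x‖ at h1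
  rw [absInftyFun] at h1
  split_ifs at h1 with h0
  · rw [← h1] at hpos
    exact absurd hpos (lt_irrefl _)
  · exact ⟨_, h1.symm⟩

theorem exists_omega : Nonempty (Omega F) := by
  obtain ⟨y, hy⟩ := IsAlgClosed.exists_pow_nat_eq
    (algebraMap (KInf F) (KInfAlg F) (polyToKInf F X)) (n := 2) (by norm_num)
  have hq := one_lt_q F
  have hy' : (y : CInf F) ^ 2 = ofPoly X := by
    have h := congrArg (UniformSpace.Completion.coeRingHom (α := KInfAlg F)) hy
    rw [map_pow] at h
    exact h
  refine ⟨⟨(y : CInf F), ?_⟩⟩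
  rintro ⟨x, hx⟩
  have h1 : ‖x‖ ^ 2 = (q : ℝ) := by
    rw [← norm_ofKInf, ← norm_pow, hx, hy', isNormEmbedding_ofPoly X X_ne_zero, natDegree_X, pow_one]
  have hx0 : x ≠ 0 := by
    rintro rfl
    rw [norm_zero] at h1
    norm_num at h1
    linarith
  obtain ⟨n, hn⟩ := exists_zpow_norm_eq hx0
  rw [hn, ← zpow_natCast, ← zpow_mul] at h1
  have h2 : (q : ℝ) ^ (n * (2 : ℕ)) = (q : ℝ) ^ (1 : ℤ) := by rw [h1, zpow_one]
  have h3 := zpow_right_injective₀ (zero_lt_one.trans hq) hq.ne' h2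
  push_cast at h3
  omega

theorem exists_lt_imDist (δ : ℝ) : ∃ z : Omega F, δ < imDist (z : CInf F) := by
  obtain ⟨z⟩ := exists_omega (F := F)
  obtain ⟨n, hn⟩ := pow_unbounded_of_one_lt (δ / imDist (z : CInf F)) (one_lt_q F)
  rw [div_lt_iff₀ (imDist_pos z)] at hn
  have h0 : ofPoly (X ^ n : F[X]) ≠ 0 := isNormEmbedding_ofPoly.ne_zero (pow_ne_zero n X_ne_zero)
  have hmem : ∀ x, ofPoly (X ^ n : F[X]) * (z : CInf F) - ofKInf F x =
      ofPoly (X ^ n : F[X]) * (z - ofKInf F (x / polyToKInf F (X ^ n))) := by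
    intro x
    rw [map_div₀, ← ofPoly_eq]
    field_simp
  refine ⟨⟨ofPoly (X ^ n : F[X]) * (z : CInf F), ?_⟩, hn.trans_le ?_⟩
  · rintro ⟨x, hx⟩
    have := hmem x
    rw [hx, sub_self] at this
    rcases mul_eq_zero.1 this.symm with h | h
    · exact h0 h
    · exact z.2 ⟨_, (sub_eq_zero.1 h).symm⟩
  · refine (Metric.le_infDist (Set.range_nonempty _)).2 ?_
    rintro _ ⟨x, rfl⟩
    rw [dist_eq_norm, hmem, norm_mul, isNormEmbedding_ofPoly _ (pow_ne_zero n X_ne_zero),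
      natDegree_X_pow]
    gcongr
    rw [← dist_eq_norm]
    exact Metric.infDist_le_dist_of_mem ⟨_, rfl⟩

end ConcreteFields

section ConcreteForms

variable {F : Type*} [Field F] [Fintype F]

local notation "q" => Fintype.card F

theorem latticeExp_mul {ϖ : CInf F} (hϖ : ϖ ≠ 0) (x : CInf F) :
    latticeExp ϖ (ϖ * x) = ϖ * latticeFun ofPoly x := by
  rw [latticeExp, latticeFun, mul_assoc]
  congr 2
  refine tprod_congr fun a => ?_
  rw [mul_div_mul_left _ _ hϖ]

theorem unif_eq {ϖ : CInf F} (hϖ : ϖ ≠ 0) (x : CInf F) :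
    unif ϖ x = (ϖ * latticeFun ofPoly x)⁻¹ := by
  rw [unif, latticeExp_mul hϖ]

theorem IsCarlitzPeriod.isCarlitzExp {ϖ : CInf F} (hϖ : IsCarlitzPeriod ϖ) :
    IsCarlitzExp ofPoly fun x => ϖ * latticeFun ofPoly x where
  add x y := by rw [latticeFun_add isNormEmbedding_ofPoly, mul_add]
  const_mul ε x := by rw [latticeFun_map_mul isNormEmbedding_ofPoly, mul_left_comm]
  X_mul x := by
    have h := hϖ.2 (ϖ * x)
    rwa [mul_left_comm, latticeExp_mul hϖ.1, latticeExp_mul hϖ.1] at h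

theorem map_pow_mul_inv_eq (ϖ : CInf F) (Q : ℕ) (z : CInf F) (c : F[X]) :
    ofPoly c ^ Q * (ϖ * latticeFun ofPoly (ofPoly c * z))⁻¹ = ϖ⁻¹ * aQuot ofPoly Q z c := by
  rw [aQuot, mul_inv, div_eq_mul_inv, mul_left_comm]

theorem aTerm_eq {ϖ : CInf F} (hϖ : ϖ ≠ 0) (l ν : ℕ) (z : Omega F) (c : {c : F[X] // c.Monic}) :
    aTerm ϖ l ν z c = ϖ⁻¹ ^ l * aQuot ofPoly (q ^ ν) (z : CInf F) c ^ l := by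
  rw [aTerm, unif_eq hϖ, mul_comm l, pow_mul, ← mul_pow, map_pow_mul_inv_eq, mul_pow]

theorem summable_aTerm {ϖ : CInf F} (hϖ : ϖ ≠ 0) {l : ℕ} (hl : 1 ≤ l) (ν : ℕ) (z : Omega F) :
    Summable (aTerm ϖ l ν z) := by
  rw [funext (aTerm_eq hϖ l ν z)]
  exact (summable_aQuot_pow isNormEmbedding_ofPoly (imDist_pos z) (farFromK_omega z) (q ^ ν)
    hl).mul_left _

theorem aForm_eq_tsum {ϖ : CInf F} (hϖ : ϖ ≠ 0) (l ν : ℕ) (z : Omega F) :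
    aForm ϖ l ν z = ϖ⁻¹ ^ l * ∑' c : {c : F[X] // c.Monic},
      aQuot ofPoly (q ^ ν) (z : CInf F) c ^ l := by
  rw [aForm, tsum_congr (aTerm_eq hϖ l ν z), tsum_mul_left]

theorem aForm_eq {ϖ : CInf F} (hϖ : ϖ ≠ 0) {l : ℕ} (hl : 1 ≤ l) (hlq : l ≤ q) (ν : ℕ)
    (z : Omega F) : aForm ϖ l ν z = (ϖ⁻¹ * aSum ofPoly (q ^ ν) (z : CInf F)) ^ l := by
  rw [aForm_eq_tsum hϖ, aSum_pow isNormEmbedding_ofPoly (imDist_pos z) (farFromK_omega z) ν hl hlq,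
    mul_pow]

theorem isRigidAnalytic_aForm {ϖ : CInf F} (hϖ : ϖ ≠ 0) {l : ℕ} (hl : 1 ≤ l) (hlq : l ≤ q)
    (ν : ℕ) : IsRigidAnalytic (aForm ϖ l ν) := by
  intro n ε hε
  have hq0 : (0 : ℝ) < q := zero_lt_one.trans (one_lt_q F)
  set S : Set (CInf F) := Subtype.val '' affinoid F n with hSdef
  have hr : 0 < ((q : ℝ) ^ n)⁻¹ := by positivity
  have hS : ∀ z ∈ S, FarFromK (ofPoly : F[X] →+* CInf F) ((q : ℝ) ^ n)⁻¹ z := by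
    rintro _ ⟨z, hz, rfl⟩
    exact farFromK_of_le_imDist hz.2
  have hR : ∀ z ∈ S, ‖z‖ ≤ (q : ℝ) ^ n := by
    rintro _ ⟨z, hz, rfl⟩
    exact hz.1
  obtain ⟨M, hM⟩ := exists_norm_aSum_le isNormEmbedding_ofPoly hr hS (q ^ ν)
  have hlim := (isRatLimitOn_aSum isNormEmbedding_ofPoly hr hS hR (q ^ ν)).const_mul ϖ⁻¹
  obtain ⟨P, Q, h⟩ := hlim.pow (M := ‖ϖ⁻¹‖ * M) (fun z hz => by
    rw [norm_mul]
    exact mul_le_mul_of_nonneg_left (hM z hz) (norm_nonneg _)) l ε hε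
  refine ⟨P, Q, fun z hz => ?_⟩
  rw [aForm_eq hϖ hl hlq]
  exact h z ⟨z, hz, rfl⟩

theorem norm_inv_mul_latticeFun_lt {ϖ : CInf F} (hϖ : ϖ ≠ 0) {R : ℝ} (hR : 0 < R) {z : CInf F}
    (hz : R / ‖ϖ‖ < imDist z) :
    ϖ * latticeFun ofPoly z ≠ 0 ∧ ‖(ϖ * latticeFun ofPoly z)⁻¹‖ < R⁻¹ := by
  have hϖ0 := norm_pos_iff.2 hϖ
  have hpos : 0 < imDist z := (div_pos hR hϖ0).trans hz
  have h := le_norm_latticeFun_mul' isNormEmbedding_ofPoly hpos (farFromK_of_le_imDist le_rfl)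
    (one_ne_zero (α := F[X]))
  rw [map_one, one_mul] at h
  rw [div_lt_iff₀' hϖ0] at hz
  have h2 : R < ‖ϖ * latticeFun ofPoly z‖ := by
    rw [norm_mul]
    exact hz.trans_le (mul_le_mul_of_nonneg_left h hϖ0.le)
  refine ⟨norm_pos_iff.1 (hR.trans h2), ?_⟩
  rw [norm_inv]
  exact inv_strictAnti₀ hR h2

theorem hasIntegralUExpansion_aForm {ϖ : CInf F} (hϖ : IsCarlitzPeriod ϖ) {l : ℕ} (hl : 1 ≤ l)
    (hlq : l ≤ q) (ν : ℕ) : HasIntegralUExpansion ϖ (aForm ϖ l ν) := by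
  have hq0 : (0 : ℝ) < q := zero_lt_one.trans (one_lt_q F)
  obtain ⟨φ, hφ⟩ := hϖ.isCarlitzExp.exists_expansion isNormEmbedding_ofPoly (q ^ ν)
  refine ⟨fun n => PowerSeries.coeff n (φ ^ l), q / ‖ϖ‖, div_pos hq0 (norm_pos_iff.2 hϖ.1),
    fun z hz => ?_⟩
  obtain ⟨h0, hu⟩ := norm_inv_mul_latticeFun_lt hϖ.1 hq0 hz
  obtain ⟨hc, hv⟩ := hφ z h0 (by
    have := mul_lt_mul_of_pos_left hu hq0
    rwa [mul_inv_cancel₀ hq0.ne'] at this)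
  simp only [map_pow_mul_inv_eq] at hv
  rw [tsum_mul_left, ← aSum] at hv
  rw [aForm_eq hϖ.1 hl hlq, ← hv, unif_eq hϖ.1, ← psEval_pow hc]
  exact (Summable.of_norm (hc.pow l)).hasSum

theorem aForm_ne_zero {ϖ : CInf F} (hϖ : IsCarlitzPeriod ϖ) {l : ℕ} (hl : 1 ≤ l)
    (hlq : l ≤ q) (ν : ℕ) : aForm ϖ l ν ≠ 0 := by
  have hq0 : (0 : ℝ) < q := zero_lt_one.trans (one_lt_q F)
  obtain ⟨z, hz⟩ := exists_lt_imDist (F := F) ((q : ℝ) ^ (q ^ ν + 2) / ‖ϖ‖)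
  obtain ⟨h0, hu⟩ := norm_inv_mul_latticeFun_lt hϖ.1 (by positivity) hz
  have hs := summable_aQuot_pow isNormEmbedding_ofPoly (imDist_pos z) (farFromK_omega z) (q ^ ν)
    le_rfl
  simp only [pow_one] at hs
  have h := hϖ.isCarlitzExp.tsum_ne_zero isNormEmbedding_ofPoly (q ^ ν) h0 hu.le (by
    simp only [map_pow_mul_inv_eq]
    exact hs.mul_left _)
  simp only [map_pow_mul_inv_eq] at h
  rw [tsum_mul_left, ← aSum] at h
  intro hzero
  have := congrFun hzero z
  rw [aForm_eq hϖ.1 hl hlq] at this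
  exact pow_ne_zero l h this

theorem aSum_affine (ν : ℕ) (a b d : F[X]) {δ : F} (hδ : δ ≠ 0) (hdet : a * d = C δ)
    (z : CInf F) :
    aSum ofPoly (q ^ ν) ((ofPoly a * z + ofPoly b) / ofPoly d) =
      ofPoly d ^ (q ^ ν + 1) * (ofPoly (C δ))⁻¹ * aSum ofPoly (q ^ ν) z := by
  have hι := isNormEmbedding_ofPoly (F := F)
  have hu : IsUnit (a * d) := by
    rw [hdet]
    exact isUnit_C.2 (isUnit_iff_ne_zero.2 hδ)
  obtain ⟨α, hα, rfl⟩ := Polynomial.isUnit_iff.1 (isUnit_of_mul_isUnit_left hu)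
  obtain ⟨β, hβ, rfl⟩ := Polynomial.isUnit_iff.1 (isUnit_of_mul_isUnit_right hu)
  have hβ0 : ofPoly (C β) ≠ 0 := hι.ne_zero (C_ne_zero.2 hβ.ne_zero)
  have hα0 : ofPoly (C α) ≠ 0 := hι.ne_zero (C_ne_zero.2 hα.ne_zero)
  have hinv : ofPoly (C β⁻¹) = (ofPoly (C β))⁻¹ := by
    refine eq_inv_of_mul_eq_one_left ?_
    rw [← map_mul, ← C_mul, inv_mul_cancel₀ hβ.ne_zero, C_1, map_one]
  have hQ := map_pow_card_pow ((ofPoly : F[X] →+* CInf F).comp C) ν β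
  rw [RingHom.comp_apply] at hQ
  have e : (ofPoly (C α) * z + ofPoly b) / ofPoly (C β) =
      ofPoly (C (α * β⁻¹)) * z + ofPoly (C β⁻¹ * b) := by
    rw [C_mul, map_mul, map_mul, hinv]
    field_simp
  rw [e, aSum_add_map hι, aSum_map_mul hι, ← hdet, pow_succ, hQ, C_mul, map_mul, map_mul, hinv]
  field_simp

/-- The transformation law of the `A`-expansion under `GL₂(A)`, by the Euclidean algorithm. -/
theorem aSum_mobius {ν : ℕ} (hν : 1 ≤ ν) (n : ℕ) (a b c d : F[X]) (hc : c.degree < n) {δ : F}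
    (hδ : δ ≠ 0) (hdet : a * d - b * c = C δ) (z : Omega F) :
    aSum ofPoly (q ^ ν)
        ((ofPoly a * (z : CInf F) + ofPoly b) / (ofPoly c * (z : CInf F) + ofPoly d)) =
      (ofPoly c * (z : CInf F) + ofPoly d) ^ (q ^ ν + 1) * (ofPoly (C δ))⁻¹ *
        aSum ofPoly (q ^ ν) (z : CInf F) := by
  have hι := isNormEmbedding_ofPoly (F := F)
  by_cases h0 : c = 0
  · subst h0
    rw [mul_zero, sub_zero] at hdet
    rw [map_zero, zero_mul, zero_add]
    exact aSum_affine ν a b d hδ hdet z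
  induction n generalizing a b c d with
  | zero =>
    rw [degree_eq_natDegree h0] at hc
    exact absurd hc (by simp)
  | succ n ih =>
    set r := a % c with hrdef
    set Q := a / c with hQdef
    have hQr : a = c * Q + r := (EuclideanDomain.div_add_mod a c).symm
    have hr : r.degree < c.degree := EuclideanDomain.mod_lt a h0
    have hrn : r.degree < n := by
      refine hr.trans_le ?_
      rw [degree_eq_natDegree h0] at hc ⊢
      have : c.natDegree < n + 1 := by exact_mod_cast hc
      exact_mod_cast Nat.lt_succ_iff.1 this
    set b' := b - Q * d with hb'
    have hdet1 : r * d - b' * c = C δ := by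
      rw [← hdet, hb']
      linear_combination -d * hQr
    have hdet2 : -c * b' - -d * r = C δ := by
      rw [← hdet1]
      ring
    have hC : (C δ : F[X]) ≠ 0 := C_ne_zero.2 hδ
    have hM1 : (!![r, b'; c, d] : Matrix (Fin 2) (Fin 2) F[X]).det ≠ 0 := by
      rw [Matrix.det_fin_two_of, hdet1]
      exact hC
    have hM2 : (!![-c, -d; r, b'] : Matrix (Fin 2) (Fin 2) F[X]).det ≠ 0 := by
      rw [Matrix.det_fin_two_of, hdet2]
      exact hC
    have hden1 : ofPoly c * (z : CInf F) + ofPoly d ≠ 0 := by simpa using denom_ne_zero hM1 z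
    have hden2 : ofPoly r * (z : CInf F) + ofPoly b' ≠ 0 := by simpa using denom_ne_zero hM2 z
    set w : CInf F := (ofPoly r * (z : CInf F) + ofPoly b') / (ofPoly c * (z : CInf F) + ofPoly d)
      with hw
    have hw0 : w ≠ 0 := div_ne_zero hden2 hden1
    have hwΩ : w = (mobius _ hM1 z : CInf F) := by simp [mobius, hw]
    have hw' : -1 / w =
        (ofPoly (-c) * (z : CInf F) + ofPoly (-d)) / (ofPoly r * (z : CInf F) + ofPoly b') := by
      rw [hw, map_neg, map_neg]
      field_simp
      ring
    have hw'Ω : -1 / w = (mobius _ hM2 z : CInf F) := by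
      rw [hw']
      simp [mobius]
    have hinv := aSum_inversion hι (imDist_pos (mobius _ hM1 z)) (imDist_pos (mobius _ hM2 z)) hw0
      (by rw [hwΩ]; exact farFromK_omega _) (by rw [hw'Ω]; exact farFromK_omega _) hν
    have hih : aSum ofPoly (q ^ ν) (-1 / w) = (ofPoly r * (z : CInf F) + ofPoly b') ^ (q ^ ν + 1) *
        (ofPoly (C δ))⁻¹ * aSum ofPoly (q ^ ν) (z : CInf F) := by
      rw [hw']
      by_cases hr0 : r = 0
      · rw [hr0, mul_zero, sub_zero] at hdet2
        rw [hr0, map_zero, zero_mul, zero_add]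
        exact aSum_affine ν (-c) (-d) b' hδ hdet2 z
      · exact ih (-c) (-d) r b' hrn hdet2 hr0
    have hshift : (ofPoly a * (z : CInf F) + ofPoly b) / (ofPoly c * (z : CInf F) + ofPoly d) =
        w + ofPoly Q := by
      rw [hw, div_add' _ _ _ hden1, hb', hQr]
      congr 1
      simp only [map_add, map_sub, map_mul]
      ring
    rw [hih] at hinv
    rw [hshift, aSum_add_map hι]
    refine mul_left_cancel₀ (pow_ne_zero (q ^ ν + 1) hw0) ?_
    have hV := pow_ne_zero (q ^ ν + 1) hden1
    rw [← hinv, hw, div_pow]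
    generalize (ofPoly c * (z : CInf F) + ofPoly d) ^ (q ^ ν + 1) = V at hV ⊢
    rw [div_mul_eq_mul_div, eq_div_iff hV]
    ring

theorem aForm_transform {ϖ : CInf F} (hϖ : ϖ ≠ 0) {l ν : ℕ} (hl : 1 ≤ l) (hlq : l ≤ q)
    (hν : 1 ≤ ν) (γ : GL (Fin 2) F[X]) (z : Omega F) :
    aForm ϖ l ν (mobius (γ : Matrix (Fin 2) (Fin 2) F[X]) (det_ne_zero_of_GL γ) z) =
      (ofPoly (γ 1 0) * (z : CInf F) + ofPoly (γ 1 1)) ^ ((l : ℤ) * (q : ℤ) ^ ν + l) *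
        ofPoly (γ : Matrix (Fin 2) (Fin 2) F[X]).det ^ (-(l : ℤ)) * aForm ϖ l ν z := by
  obtain ⟨δ, hδ, hdet⟩ := Polynomial.isUnit_iff.1
    ((Matrix.isUnit_iff_isUnit_det (γ : Matrix (Fin 2) (Fin 2) F[X])).1 γ.isUnit)
  have hdet' := hdet
  rw [Matrix.det_fin_two] at hdet'
  have h := aSum_mobius hν ((γ 1 0).natDegree + 1) (γ 0 0) (γ 0 1) (γ 1 0) (γ 1 1)
    (degree_le_natDegree.trans_lt (by exact_mod_cast Nat.lt_succ_self _)) hδ.ne_zero hdet'.symm z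
  rw [aForm_eq hϖ hl hlq, aForm_eq hϖ hl hlq, ← hdet]
  have hexp : (l : ℤ) * (q : ℤ) ^ ν + l = ((l * q ^ ν + l : ℕ) : ℤ) := by push_cast; ring
  rw [hexp, zpow_natCast, zpow_neg, zpow_natCast, mobius, h,
    show l * q ^ ν + l = (q ^ ν + 1) * l by ring, pow_mul, ← inv_pow, mul_pow, mul_pow, mul_pow,
    mul_pow]
  exact mul_left_comm _ _ _

theorem finsum_degreeLT {M : Type*} [AddCommMonoid M] (n : ℕ) (g : F[X] → M) :
    ∑ᶠ b : Polynomial.degreeLT F n, g b = ∑ b ∈ degLT F n, g b := by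
  have h : (Polynomial.degreeLT F n : Set F[X]) = (degLT F n : Set F[X]) := by
    ext a
    simp [mem_degLT, mem_degreeLT]
  rw [← finsum_mem_coe_finset, ← h]
  exact finsum_set_coe_eq_finsum_mem (f := g) (Polynomial.degreeLT F n : Set F[X])

theorem hecke_aForm {ϖ : CInf F} (hϖ : ϖ ≠ 0) {l : ℕ} (hl : 1 ≤ l) (hlq : l ≤ q) (ν : ℕ)
    {p : F[X]} (hp : p.Monic) (hirr : Irreducible p) (z : Omega F) :
    hecke ((l : ℤ) * (q : ℤ) ^ ν + l) p hp.ne_zero (aForm ϖ l ν) z =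
      ofPoly p ^ l * aForm ϖ l ν z := by
  have h := hecke_tsum_aQuot_pow isNormEmbedding_ofPoly (imDist_pos z) (farFromK_omega z) (q ^ ν)
    hp hirr hl hlq
  have hexp : (l : ℤ) * (q : ℤ) ^ ν + l = ((l * q ^ ν + l : ℕ) : ℤ) := by push_cast; ring
  have h1 : ∀ hM, (mobius !![p, 0; 0, 1] hM z : CInf F) = ofPoly p * z := by
    intro hM
    simp [mobius]
  have h2 : ∀ (b : F[X]) hM, (mobius !![1, b; 0, p] hM z : CInf F) = (z + ofPoly b) / ofPoly p := by
    intro b hM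
    simp [mobius]
  rw [hecke, hexp, zpow_natCast]
  simp only [aForm_eq_tsum hϖ, h1, h2]
  rw [finsum_degreeLT p.natDegree fun b => ϖ⁻¹ ^ l * ∑' c : {c : F[X] // c.Monic},
    aQuot ofPoly (q ^ ν) (((z : CInf F) + ofPoly b) / ofPoly p) (c : F[X]) ^ l, ← Finset.mul_sum]
  linear_combination ϖ⁻¹ ^ l * h

theorem isHeckeEigenform_aForm {ϖ : CInf F} (hϖ : IsCarlitzPeriod ϖ) {l ν : ℕ} (hl : 1 ≤ l)
    (hlq : l ≤ q) (hν : 1 ≤ ν) :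
    IsHeckeEigenform ϖ ((l : ℤ) * (q : ℤ) ^ ν + l) l (aForm ϖ l ν) where
  modular :=
    { rigidAnalytic := isRigidAnalytic_aForm hϖ.1 hl hlq ν
      transform := aForm_transform hϖ.1 hl hlq hν
      uExpansion := hasIntegralUExpansion_aForm hϖ hl hlq ν }
  ne_zero := aForm_ne_zero hϖ hl hlq ν
  eigen p hp hirr := ⟨ofPoly p ^ l, hecke_aForm hϖ.1 hl hlq ν hp hirr⟩

end ConcreteForms

end Drinfeld

end

theorem corollary4p8 {F : Type*} [Field F] [Fintype F]
    (ϖ : Drinfeld.CInf F) (hϖ : Drinfeld.IsCarlitzPeriod ϖ)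
    (l ν : ℕ) (hl : 1 ≤ l) (hlq : l ≤ Fintype.card F) (hν : 1 ≤ ν) :
    (∀ z : Drinfeld.Omega F,
      Summable (Drinfeld.aTerm ϖ 1 ν z) ∧ Summable (Drinfeld.aTerm ϖ l ν z)) ∧
    Drinfeld.IsHeckeEigenform ϖ ((Fintype.card F : ℤ) ^ ν + 1) 1 (Drinfeld.aForm ϖ 1 ν) ∧
    Drinfeld.IsHeckeEigenform ϖ (l * (Fintype.card F : ℤ) ^ ν + l) l (Drinfeld.aForm ϖ l ν) ∧
    Drinfeld.aForm ϖ 1 ν ^ l = Drinfeld.aForm ϖ l ν := by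
  have h1q : 1 ≤ Fintype.card F := Fintype.card_pos
  refine ⟨fun z => ⟨Drinfeld.summable_aTerm hϖ.1 le_rfl ν z, Drinfeld.summable_aTerm hϖ.1 hl ν z⟩,
    ?_, Drinfeld.isHeckeEigenform_aForm hϖ hl hlq hν, ?_⟩
  · have h := Drinfeld.isHeckeEigenform_aForm hϖ le_rfl h1q hν
    rwa [Nat.cast_one, one_mul] at h
  · funext z
    rw [Pi.pow_apply, Drinfeld.aForm_eq hϖ.1 le_rfl h1q, Drinfeld.aForm_eq hϖ.1 hl hlq, pow_one]
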